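/- Let $0<q_1,q_2,q<1$ be independent parameters (no relation among them is assumed). For a partition $\lambda=(\lambda_1\ge\lambda_2\ge\cdots)$ let $s_\lambda(q^\rho)=\sum_{T}\prod_{(i,j)\in\lambda}x_{T(i,j)}$ be the Schur function, summed over the semistandard tableaux $T$ of shape $\lambda$ with entries $0,1,2,\dots$, at $x_m=q^{m+1/2}$. For $p\in\mathbf Z$ and $k\ge1$ put $$\Phi_k(\lambda,p)=\sum_{i\ge1}\bigl(q^{k(p+\lambda_i-i+1)}-q^{k(p-i+1)}\bigr)+q^k\,\frac{1-q^{pk}}{1-q^k}.$$ Let $\boldsymbol t=(t_1,t_2,\dots)$ be complex numbers such that $\Phi(\boldsymbol t,\lambda,p)=\sum_{k\ge1}t_k\Phi_k(\lambda,p)$ converges absolutely for all $\lambda$ and $p$ (for example, only finitely many $t_k$ are nonzero), and let $$Z(\boldsymbol t,Q,p;q_1,q_2)=\sum_\lambda s_\lambda(q_1^\rho)\,s_\lambda(q_2^\rho)\,Q^{|\lambda|+p(p+1)/2}\,e^{\Phi(\boldsymbol t,\lambda,p)} .$$ Theorem 3. For every $p\in\mathbf Z$, $$Z(\boldsymbol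 t,q_1q_2Q,p;q_1,q_2)\,Z(\boldsymbol t,Q,p;q_1,q_2)-Z(\boldsymbol t,q_1Q,p;q_1,q_2)\,Z(\boldsymbol t,q_2Q,p;q_1,q_2)=(q_1q_2)^{p+1/2}\,Z(\boldsymbol t,Q,p+1;q_1,q_2)\,Z(\boldsymbol t,q_1q_2Q,p-1;q_1,q_2).$$ This holds as an identity of formal power series in $Q$, and also as an identity of complex numbers for every $Q\in\mathbf C$ at which the series $Z(\boldsymbol t,Q,p)$, $Z(\boldsymbol t,Q,p+1)$ and $Z(\boldsymbol t,q_1q_2Q,p-1)$ converge absolutely. -/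

import Mathlib

namespace MeltingCrystal

/-- The monomial `x^T = ∏_{(i,j) ∈ μ} x_{T(i,j)}` of a semistandard tableau `T` of shape `μ`, at
`x = q^ρ = (q^{1/2}, q^{3/2}, …, q^{m+1/2}, …)`.  Entries and variables are both numbered from `0`,
so that `x_m = q^{m+1/2}`. -/
noncomputable def tableauWeight (q : ℝ) {μ : YoungDiagram} (T : SemistandardYoungTableau μ) : ℝ :=
  ∏ c ∈ μ.cells, q ^ ((T c.1 c.2 : ℝ) + 1 / 2)

/-- The special value `s_μ(q^ρ)` of the Schur function in infinitely many variables: the sum of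
`x^T` over all semistandard tableaux `T` of shape `μ`, at `x = q^ρ`. -/
noncomputable def schurRho (q : ℝ) (μ : YoungDiagram) : ℝ :=
  ∑' T : SemistandardYoungTableau μ, tableauWeight q T

/-- A product of convergent nonnegative series over a finite index type converges. -/
theorem summable_prod_fintype {ι : Type*} [Fintype ι] {g : ℕ → ℝ}
    (hg : Summable g) (h0 : ∀ n, 0 ≤ g n) :
    Summable (fun f : ι → ℕ => ∏ i, g (f i)) := by
  classical
  refine summable_of_sum_le (c := ∏ _i : ι, ∑' n, g n)
    (fun f => Finset.prod_nonneg fun i _ => h0 _) fun u => ?_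
  let s : Finset ℕ := u.biUnion fun f => Finset.univ.image f
  have hu : u ⊆ Fintype.piFinset fun _ : ι => s := by
    intro f hf
    rw [Fintype.mem_piFinset]
    intro i
    exact Finset.mem_biUnion.2 ⟨f, hf, Finset.mem_image_of_mem _ (Finset.mem_univ i)⟩
  calc ∑ f ∈ u, ∏ i, g (f i)
      ≤ ∑ f ∈ Fintype.piFinset fun _ : ι => s, ∏ i, g (f i) :=
        Finset.sum_le_sum_of_subset_of_nonneg hu
          fun f _ _ => Finset.prod_nonneg fun i _ => h0 _
    _ = ∏ _i : ι, ∑ n ∈ s, g n := (Finset.prod_univ_sum (fun _ : ι => s) fun _ n => g n).symm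
    _ ≤ ∏ _i : ι, ∑' n, g n :=
        Finset.prod_le_prod (fun _ _ => Finset.sum_nonneg fun n _ => h0 n)
          fun _ _ => hg.sum_le_tsum _ fun n _ => h0 n

/-- The series that defines `s_μ(q^ρ)` converges for `0 < q < 1`. -/
theorem summable_tableauWeight {q : ℝ} (hq : 0 < q) (hq1 : q < 1) (μ : YoungDiagram) :
    Summable (fun T : SemistandardYoungTableau μ => tableauWeight q T) := by
  have hg : Summable fun n : ℕ => q ^ ((n : ℝ) + 1 / 2) := by
    have := (summable_geometric_of_lt_one hq.le hq1).mul_right (q ^ (1 / 2 : ℝ))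
    refine this.congr fun n => ?_
    rw [Real.rpow_add hq, Real.rpow_natCast]
  have h := summable_prod_fintype (ι := μ.cells) hg fun n => (Real.rpow_pos_of_pos hq _).le
  let e : SemistandardYoungTableau μ → (μ.cells → ℕ) := fun T c => T c.1.1 c.1.2
  have he : Function.Injective e := by
    intro T T' hT
    ext i j
    by_cases hij : (i, j) ∈ μ
    · exact congrFun hT ⟨(i, j), (YoungDiagram.mem_cells _).2 hij⟩
    · rw [T.zeros hij, T'.zeros hij]
  refine (h.comp_injective he).congr fun T => ?_
  simp only [tableauWeight, Function.comp, e]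
  exact Finset.prod_coe_sort μ.cells fun c => q ^ ((T c.1 c.2 : ℝ) + 1 / 2)

/-- The potential
`Φ_k(μ,p) = ∑_{i ≥ 1} (q^{k(p+μ_i-i+1)} - q^{k(p-i+1)}) + q^k (1 - q^{pk}) / (1 - q^k)`.
Here the rows are numbered from `0`, and the sum is restricted to the nonempty rows: all other
terms vanish. -/
noncomputable def potential (q : ℝ) (k : ℕ+) (μ : YoungDiagram) (p : ℤ) : ℝ :=
  ∑ i ∈ Finset.range (μ.colLen 0),
      (q ^ ((k : ℤ) * (p + (μ.rowLen i : ℤ) - (i : ℤ))) - q ^ ((k : ℤ) * (p - (i : ℤ))))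
    + q ^ (k : ℤ) * (1 - q ^ (p * (k : ℤ))) / (1 - q ^ (k : ℤ))

/-- The coupling constants `t = (t_1, t_2, …)` are admissible if the series
`∑_k t_k Φ_k(μ,p)` converges for every partition `μ` and every integer `p`. -/
def Admissible (q : ℝ) (t : ℕ+ → ℂ) : Prop :=
  ∀ (μ : YoungDiagram) (p : ℤ), Summable fun k : ℕ+ => t k * (potential q k μ p : ℂ)

/-- `Φ(t,μ,p) = ∑_{k ≥ 1} t_k Φ_k(μ,p)`. -/
noncomputable def totalPotential (q : ℝ) (t : ℕ+ → ℂ) (μ : YoungDiagram) (p : ℤ) : ℂ :=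
  ∑' k : ℕ+, t k * (potential q k μ p : ℂ)

/-- The exponent `|μ| + p(p+1)/2` of `Q`, which is a nonnegative integer for every integer `p`. -/
def energy (μ : YoungDiagram) (p : ℤ) : ℕ :=
  μ.card + (p * (p + 1) / 2).toNat

/-- The coefficient `s_μ(q₁^ρ) s_μ(q₂^ρ) e^{Φ(t,μ,p)}` with which the partition `μ` enters the
partition function. -/
noncomputable def weight (q₁ q₂ q : ℝ) (t : ℕ+ → ℂ) (p : ℤ) (μ : YoungDiagram) : ℂ :=
  (schurRho q₁ μ : ℂ) * (schurRho q₂ μ : ℂ) * Complex.exp (totalPotential q t μ p)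

/-- Only finitely many partitions carry a given power of `Q`. -/
theorem finite_energy_eq (p : ℤ) (n : ℕ) : {μ : YoungDiagram | energy μ p = n}.Finite := by
  have hinj : Function.Injective YoungDiagram.cells := fun μ ν h => YoungDiagram.ext h
  refine Set.Finite.of_finite_image (f := YoungDiagram.cells) ?_ hinj.injOn
  refine (Finset.finite_toSet (Finset.range n ×ˢ Finset.range n).powerset).subset ?_
  rintro _ ⟨μ, hμ, rfl⟩
  have hcard : μ.cells.card ≤ n := by
    have : μ.cells.card + (p * (p + 1) / 2).toNat = n := hμ
    omega
  rw [Finset.mem_coe, Finset.mem_powerset]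
  rintro ⟨i, j⟩ hij
  have hmem : (i, j) ∈ μ := (YoungDiagram.mem_cells _).1 hij
  have h1 : j < μ.rowLen i := YoungDiagram.mem_iff_lt_rowLen.1 hmem
  have h2 : i < μ.colLen j := YoungDiagram.mem_iff_lt_colLen.1 hmem
  have h3 : μ.rowLen i ≤ μ.cells.card := by
    rw [YoungDiagram.rowLen_eq_card]
    exact Finset.card_le_card (Finset.filter_subset _ _)
  have h4 : μ.colLen j ≤ μ.cells.card := by
    rw [YoungDiagram.colLen_eq_card]
    exact Finset.card_le_card (Finset.filter_subset _ _)
  rw [Finset.mem_product, Finset.mem_range, Finset.mem_range]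
  exact ⟨by simpa using by omega, by simpa using by omega⟩

/-- The partition function
`Z(t,Q,p;q₁,q₂) = ∑_μ s_μ(q₁^ρ) s_μ(q₂^ρ) Q^{|μ|+p(p+1)/2} e^{Φ(t,μ,p)}` as a formal power series
in `Q`. -/
noncomputable def formalZ (q₁ q₂ q : ℝ) (t : ℕ+ → ℂ) (p : ℤ) : PowerSeries ℂ :=
  PowerSeries.mk fun n => ∑ μ ∈ (finite_energy_eq p n).toFinset, weight q₁ q₂ q t p μ

/-- The terms of the partition function at a numerical value of `Q`. -/
noncomputable def term (q₁ q₂ q : ℝ) (t : ℕ+ → ℂ) (Q : ℂ) (p : ℤ) (μ : YoungDiagram) : ℂ :=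
  weight q₁ q₂ q t p μ * Q ^ energy μ p

/-- The partition function `Z(t,Q,p;q₁,q₂)` at a numerical value of `Q`. -/
noncomputable def numZ (q₁ q₂ q : ℝ) (t : ℕ+ → ℂ) (Q : ℂ) (p : ℤ) : ℂ :=
  ∑' μ : YoungDiagram, term q₁ q₂ q t Q p μ

end MeltingCrystal

/-!
Replace a partition `μ` with at most `n` rows by the strictly increasing sequence
`l_k = μ_{n-k} + k`, `0 ≤ k < n` (`shiftedParts`).  Then `e^{Φ(t,μ,p)}` is, up to a factor that
depends on `p - n` only, the product of the one-site weights `h_m = exp (∑ t_k q^{k(p-n+1+m)})`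
over the entries `m` of the sequence (`exp_totalPotential`), and the Schur polynomial
`s_μ(x_0, …, x_{n-1})` is the quotient of the alternant `det (x_i ^ l_k)` by the Vandermonde
product (`vandermondeProd_mul_schurPoly`).  By the Cauchy–Binet formula (`coeff_det_mk`), the
partition function with Schur functions truncated to `n` variables is therefore an elementary
factor times the determinant

  `D_n = det (∑_m h_m (x_i y_j Q)^m)_{0 ≤ i, j < n}`,  `x_i = q₁^{i+1/2}`,  `y_j = q₂^{j+1/2}`

(`momentDet_eq_truncatedZ`).  For a fixed sequence `h`, the size `n` plays the role of the charge:
`D_{n+2}`, `D_{n+1}`, `D_n` belong to the charges `p + 1`, `p`, `p - 1`.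

Since `x_{i+1} = q₁ x_i` and `y_{j+1} = q₂ y_j`, deleting the first instead of the last row or
column of the matrix of `D_{n+2}` replaces `Q` by `q₁ Q` or `q₂ Q`.  The Desnanot–Jacobi identity
(`desnanot_jacobi`) for the corner minors of this matrix is thus a bilinear identity between
`D_{n+2}`, `D_{n+1}` and `D_n` (`momentDet_desnanot_jacobi`), which becomes the asserted one,
except for the factors `1 - q₁^{n+1}` and `1 - q₂^{n+1}` on the right-hand side
(`truncatedZ_bilinear`).  These tend to `1` as `n → ∞`, while each coefficient of the truncated
partition functions converges to that of the partition function (`tendsto_truncatedZ`).  This is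
the identity of formal power series.  At a number `Q` where the series converge absolutely, the
power series in `Q` converge absolutely too, and Cauchy products give the numerical identity.
-/

namespace MeltingCrystal

/-! ### The Desnanot–Jacobi identity -/

section DesnanotJacobi

open Matrix

/-- Multiply `A` by the identity matrix with its first two columns replaced by those of the
adjugate of `A`, and take determinants. -/
theorem det_mul_det_adjugate_corner {R m : Type*} [CommRing R] [Fintype m] [DecidableEq m]
    (A : Matrix (Fin 2 ⊕ m) (Fin 2 ⊕ m) R) :
    A.adjugate.toBlocks₁₁.det * A.det = A.det * A.det * A.toBlocks₂₂.det := by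
  have key : ∀ (A A' : Matrix (Fin 2 ⊕ m) (Fin 2 ⊕ m) R) (d : R), A * A' = d • 1 →
      A * fromBlocks A'.toBlocks₁₁ 0 A'.toBlocks₂₁ 1 =
        fromBlocks (d • (1 : Matrix (Fin 2) (Fin 2) R)) A.toBlocks₁₂ 0 A.toBlocks₂₂ := by
    intro A A' d h
    rw [← fromBlocks_toBlocks A, ← fromBlocks_toBlocks A', fromBlocks_multiply,
      ← fromBlocks_one, fromBlocks_smul, fromBlocks_inj] at h
    obtain ⟨h1, -, h3, -⟩ := h
    conv_lhs => rw [← fromBlocks_toBlocks A]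
    rw [fromBlocks_multiply, h1, h3]
    simp
  have hAB := key A A.adjugate A.det A.mul_adjugate
  have h := congrArg Matrix.det hAB
  rw [det_mul, det_fromBlocks_zero₁₂, det_fromBlocks_zero₂₁, det_smul] at h
  simp only [det_one, mul_one, Fintype.card_fin] at h
  rw [mul_comm, h]
  ring

/-- **Jacobi's theorem** on the `2 × 2` minors of the adjugate matrix. -/
theorem det_adjugate_corner {R m : Type*} [CommRing R] [Fintype m] [DecidableEq m]
    (A : Matrix (Fin 2 ⊕ m) (Fin 2 ⊕ m) R) :
    A.adjugate.toBlocks₁₁.det = A.det * A.toBlocks₂₂.det := by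
  -- It suffices to treat the matrix of indeterminates, whose determinant can be cancelled.
  let X := mvPolynomialX (Fin 2 ⊕ m) (Fin 2 ⊕ m) ℤ
  have hX : X.adjugate.toBlocks₁₁.det = X.det * X.toBlocks₂₂.det := by
    refine mul_right_cancel₀ (det_mvPolynomialX_ne_zero (Fin 2 ⊕ m) ℤ) ?_
    rw [show mvPolynomialX (Fin 2 ⊕ m) (Fin 2 ⊕ m) ℤ = X from rfl, det_mul_det_adjugate_corner]
    ring
  let f : MvPolynomial ((Fin 2 ⊕ m) × (Fin 2 ⊕ m)) ℤ →+* R :=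
    (MvPolynomial.aeval fun p : (Fin 2 ⊕ m) × (Fin 2 ⊕ m) => A p.1 p.2).toRingHom
  have hf : f.mapMatrix X = A := by
    ext i j
    simp [f, X]
  have h := congrArg f hX
  rw [map_mul, RingHom.map_det, RingHom.map_det, RingHom.map_det, hf] at h
  have h1 : f.mapMatrix X.adjugate.toBlocks₁₁ = A.adjugate.toBlocks₁₁ := by
    rw [← hf, ← RingHom.map_adjugate]
    rfl
  have h2 : f.mapMatrix X.toBlocks₂₂ = A.toBlocks₂₂ := by
    rw [← hf]
    rfl
  rwa [h1, h2] at h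

/-- The numbering of `Fin (n + 2)` that lists the two end points first. -/
noncomputable def finEndsEquiv (n : ℕ) : Fin 2 ⊕ Fin n ≃ Fin (n + 2) :=
  Equiv.ofBijective (Sum.elim ![0, Fin.last (n + 1)] fun i => i.castSucc.succ) <| by
    rw [Fintype.bijective_iff_injective_and_card]
    refine ⟨?_, by simp [add_comm]⟩
    rintro (i | i) (j | j) h
    · fin_cases i <;> fin_cases j <;> simp [Fin.ext_iff] at h ⊢
    · fin_cases i <;> simp [Fin.ext_iff] at h
      have := j.2
      omega
    · fin_cases j <;> simp [Fin.ext_iff] at h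
      have := i.2
      omega
    · simpa [Fin.ext_iff] using h

/-- The **Desnanot–Jacobi identity** for the four corner minors of a square matrix. -/
theorem desnanot_jacobi {R : Type*} [CommRing R] {n : ℕ}
    (A : Matrix (Fin (n + 2)) (Fin (n + 2)) R) :
    A.det * (A.submatrix (fun i : Fin n => i.castSucc.succ) fun i : Fin n => i.castSucc.succ).det
      = (A.submatrix Fin.succ Fin.succ).det * (A.submatrix Fin.castSucc Fin.castSucc).det
        - (A.submatrix Fin.succ Fin.castSucc).det * (A.submatrix Fin.castSucc Fin.succ).det := by
  have h := det_adjugate_corner (A.submatrix (finEndsEquiv n) (finEndsEquiv n))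
  rw [adjugate_submatrix_equiv_self, det_submatrix_equiv_self, det_fin_two] at h
  simp only [toBlocks₁₁, submatrix_apply, of_apply, finEndsEquiv, Equiv.ofBijective_apply,
    Sum.elim_inl, cons_val_zero, cons_val_one, adjugate_fin_succ_eq_det_submatrix] at h
  have e0 : (Fin.succAbove (0 : Fin (n + 2))) = Fin.succ := by
    funext i; simp
  have e1 : (Fin.succAbove (Fin.last (n + 1))) = Fin.castSucc := by
    funext i; simp
  rw [e0, e1] at h
  have hsq : ((-1 : R) ^ (n + 1)) * (-1) ^ (n + 1) = 1 := by
    rw [← mul_pow]; simp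
  have e3 : A.det * (A.submatrix (fun i : Fin n => i.castSucc.succ)
      fun i : Fin n => i.castSucc.succ).det = _ := h.symm
  rw [e3]
  simp only [Fin.val_zero, Fin.val_last, zero_add, add_zero, pow_zero, one_mul, pow_add] at hsq ⊢
  linear_combination ((A.submatrix Fin.succ Fin.succ).det *
      (A.submatrix Fin.castSucc Fin.castSucc).det
    - (A.submatrix Fin.succ Fin.castSucc).det * (A.submatrix Fin.castSucc Fin.succ).det) * hsq

end DesnanotJacobi

open Finset Filter Topology

/-! ### The Cauchy–Binet formula for determinants of power series -/

/-- The strictly increasing sequences of `n` natural numbers with sum `d`. -/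
def strictMonoSeqs (n d : ℕ) : Finset (Fin n → ℕ) :=
  {l ∈ piAntidiag univ d | StrictMono l}

theorem mem_strictMonoSeqs {n d : ℕ} {l : Fin n → ℕ} :
    l ∈ strictMonoSeqs n d ↔ ∑ k, l k = d ∧ StrictMono l := by
  simp [strictMonoSeqs]

theorem coeff_prod_univ {R : Type*} [CommRing R] {n : ℕ} (f : Fin n → PowerSeries R) (d : ℕ) :
    PowerSeries.coeff d (∏ i, f i) =
      ∑ l ∈ piAntidiag univ d, ∏ i, PowerSeries.coeff (l i) (f i) := by
  rw [PowerSeries.coeff_prod]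
  refine sum_nbij' (fun l => (l : Fin n → ℕ)) Finsupp.equivFunOnFinite.symm ?_ ?_ ?_ ?_ ?_
  · intro l hl
    simp only [mem_finsuppAntidiag] at hl
    simp [hl.1]
  · intro l hl
    simp only [mem_piAntidiag] at hl
    simp [mem_finsuppAntidiag, hl.1]
  · intro l _
    simp
  · intro l _
    simp
  · intro l _
    rfl

/-- A function that vanishes on sequences with a repeated entry may be summed over increasing
sequences and their rearrangements. -/
theorem sum_piAntidiag_eq_sum_strictMonoSeqs {M : Type*} [AddCommMonoid M] {n : ℕ} (d : ℕ)
    (F : (Fin n → ℕ) → M) (hF : ∀ l, ¬ Function.Injective l → F l = 0) :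
    ∑ l ∈ piAntidiag univ d, F l =
      ∑ l ∈ strictMonoSeqs n d, ∑ τ : Equiv.Perm (Fin n), F (l ∘ τ) := by
  rw [← sum_product']
  symm
  refine sum_of_injOn (fun z => z.1 ∘ z.2) ?_ ?_ ?_ ?_
  · rintro ⟨l, τ⟩ hl ⟨l', τ'⟩ hl' h
    simp only [coe_product, Set.mem_prod, mem_coe, mem_strictMonoSeqs] at hl hl'
    simp only at h
    have hr : Set.range l = Set.range l' := by
      rw [← τ.surjective.range_comp l, ← τ'.surjective.range_comp l', h]
    obtain rfl : l = l' := (StrictMono.range_inj hl.1.2 hl'.1.2).1 hr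
    congr 1
    ext i
    exact congrArg Fin.val (hl.1.2.injective (congrFun h i))
  · rintro ⟨l, τ⟩ hl
    simp only [coe_product, Set.mem_prod, mem_coe, mem_strictMonoSeqs] at hl
    simp only [mem_coe, mem_piAntidiag, Function.comp, mem_univ, implies_true, and_true]
    rw [Equiv.sum_comp τ l]
    exact hl.1.1
  · intro l hl hl'
    refine hF l fun hinj => hl' ?_
    refine ⟨(l ∘ Tuple.sort l, (Tuple.sort l)⁻¹), ?_, ?_⟩
    · simp only [coe_product, Set.mem_prod, mem_coe, mem_strictMonoSeqs, mem_univ, and_true]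
      refine ⟨?_, (Tuple.monotone_sort l).strictMono_of_injective
        (hinj.comp (Tuple.sort l).injective)⟩
      simp only [Function.comp]
      rw [Equiv.sum_comp (Tuple.sort l) l]
      exact (mem_piAntidiag.1 hl).1
    · ext i
      simp
  · intro z _
    rfl

/-- The **Cauchy–Binet formula** for the `n × ∞` matrices `a` and `b` and the diagonal matrix of
the `h m * X ^ m`. -/
theorem coeff_det_mk {R : Type*} [CommRing R] {n : ℕ} (h : ℕ → R) (a b : Fin n → ℕ → R) (d : ℕ) :
    PowerSeries.coeff d
        (Matrix.of fun i j : Fin n => PowerSeries.mk fun m => h m * a i m * b j m).det =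
      ∑ l ∈ strictMonoSeqs n d, (∏ k, h (l k)) *
        (Matrix.of fun k i : Fin n => a i (l k)).det *
        (Matrix.of fun k j : Fin n => b j (l k)).det := by
  have hT (l : Fin n → ℕ) : (Matrix.of fun k i : Fin n => a i (l k)).det
      = (Matrix.of fun i k : Fin n => a i (l k)).det := Matrix.det_transpose _
  have h1 : PowerSeries.coeff d
        (Matrix.of fun i j : Fin n => PowerSeries.mk fun m => h m * a i m * b j m).det =
      ∑ l ∈ piAntidiag univ d, (∏ k, h (l k)) * (∏ j, b j (l j)) *
        (Matrix.of fun k i : Fin n => a i (l k)).det := by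
    simp only [hT]
    simp only [Matrix.det_apply', map_sum, mul_sum, Matrix.of_apply]
    rw [sum_comm]
    refine sum_congr rfl fun σ _ => ?_
    have hs : ((Equiv.Perm.sign σ : ℤ) : PowerSeries R) =
        PowerSeries.C ((Equiv.Perm.sign σ : ℤ) : R) := by simp
    rw [hs, PowerSeries.coeff_C_mul, coeff_prod_univ, mul_sum]
    refine sum_congr rfl fun l _ => ?_
    simp only [PowerSeries.coeff_mk, prod_mul_distrib]
    ring
  rw [h1, sum_piAntidiag_eq_sum_strictMonoSeqs]
  · refine sum_congr rfl fun l _ => ?_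
    have hb : (Matrix.of fun k j : Fin n => b j (l k)).det =
        ∑ τ : Equiv.Perm (Fin n), ((Equiv.Perm.sign τ : ℤ) : R) * ∏ j, b j (l (τ j)) := by
      rw [Matrix.det_apply']
      rfl
    rw [hb, mul_sum]
    refine sum_congr rfl fun τ _ => ?_
    have ha : (Matrix.of fun k i : Fin n => a i ((l ∘ τ) k)).det =
        ((Equiv.Perm.sign τ : ℤ) : R) * (Matrix.of fun k i : Fin n => a i (l k)).det :=
      Matrix.det_permute τ (Matrix.of fun k i : Fin n => a i (l k))
    rw [ha]
    simp only [Function.comp]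
    rw [Equiv.prod_comp τ fun k => h (l k)]
    ring
  · intro l hl
    obtain ⟨i, j, hij, hne⟩ : ∃ i j, l i = l j ∧ i ≠ j := by
      simpa [Function.Injective] using hl
    rw [Matrix.det_zero_of_row_eq hne (by ext k; simp [hij]), mul_zero]

/-! ### Alternants -/

/-- The alternant `det (x_i ^ l_k)` in the first `n` of the variables `x`. -/
def alternant {R : Type*} [CommRing R] (x : ℕ → R) {n : ℕ} (l : Fin n → ℕ) : R :=
  (Matrix.of fun k i : Fin n => x i ^ l k).det

/-- The Vandermonde product of the first `n` of the variables `x`. -/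
def vandermondeProd {R : Type*} [CommRing R] (x : ℕ → R) (n : ℕ) : R :=
  ∏ k ∈ range n, ∏ i ∈ range k, (x k - x i)

theorem vandermondeProd_succ {R : Type*} [CommRing R] (x : ℕ → R) (n : ℕ) :
    vandermondeProd x (n + 1) = vandermondeProd x n * ∏ i ∈ range n, (x n - x i) := by
  rw [vandermondeProd, prod_range_succ]
  rfl

theorem pow_sub_mul_pow_eq_sum {R : Type*} [CommRing R] (a b : R) {s t : ℕ} (h : s ≤ t) :
    a ^ t - b ^ (t - s) * a ^ s = (a - b) * ∑ m ∈ Ico s t, b ^ (t - 1 - m) * a ^ m := by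
  obtain ⟨r, rfl⟩ := Nat.exists_eq_add_of_le h
  rw [sum_Ico_eq_sum_range, Nat.add_sub_cancel_left]
  have h1 := (Commute.all a b).mul_geom_sum₂ r
  have h2 : ∑ k ∈ range r, b ^ (s + r - 1 - (s + k)) * a ^ (s + k) =
      (∑ i ∈ range r, a ^ i * b ^ (r - 1 - i)) * a ^ s := by
    rw [sum_mul]
    refine sum_congr rfl fun k _ => ?_
    rw [show s + r - 1 - (s + k) = r - 1 - k by omega]
    ring
  rw [h2, ← mul_assoc, h1]
  ring

/-- The alternants satisfy the branching rule of the Schur polynomials: the last variable is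
split off, and the new exponents interlace the old ones. -/
theorem alternant_succ {R : Type*} [CommRing R] (x : ℕ → R) {n : ℕ} {l : Fin (n + 1) → ℕ}
    (hl : Monotone l) :
    alternant x l = (∏ i ∈ range n, (x n - x i)) *
      ∑ m ∈ Fintype.piFinset fun k : Fin n => Ico (l k.castSucc) (l k.succ),
        (x n ^ l 0 * ∏ k : Fin n, x n ^ (l k.succ - 1 - m k)) * alternant x m := by
  -- Subtracting multiples of consecutive rows clears the last column below its first entry.
  let B : Matrix (Fin (n + 1)) (Fin (n + 1)) R := Matrix.of <| Fin.cons (fun i => x i ^ l 0)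
    fun k i => x i ^ l k.succ - x n ^ (l k.succ - l k.castSucc) * x i ^ l k.castSucc
  have hB : alternant x l = B.det := by
    refine Matrix.det_eq_of_forall_row_eq_smul_add_pred
      (fun k => x n ^ (l k.succ - l k.castSucc)) ?_ ?_
    · intro j
      simp [B]
    · intro k j
      simp [B]
  rw [hB, Matrix.det_succ_column B (Fin.last n), Fin.sum_univ_succ]
  have hz (k : Fin n) : B k.succ (Fin.last n) = 0 := by
    have : l k.castSucc ≤ l k.succ := hl k.castSucc_lt_succ.le
    simp only [B, Matrix.of_apply, Fin.cons_succ, Fin.val_last]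
    rw [← pow_add, Nat.sub_add_cancel this, sub_self]
  simp only [hz, mul_zero, zero_mul, sum_const_zero, add_zero]
  have h0 : B 0 (Fin.last n) = x n ^ l 0 := by simp [B]
  let S : Matrix (Fin n) (Fin n) R := Matrix.of fun k i =>
    (∑ m ∈ Ico (l k.castSucc) (l k.succ), x n ^ (l k.succ - 1 - m) • fun i : Fin n => x i ^ m) i
  have hsub : B.submatrix (Fin.succAbove 0) (Fin.last n).succAbove =
      Matrix.of fun k i : Fin n => (x i - x n) * S k i := by
    ext k i
    have : l k.castSucc ≤ l k.succ := hl k.castSucc_lt_succ.le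
    simp only [Matrix.submatrix_apply, Fin.zero_succAbove, Fin.succAbove_last, B, Matrix.of_apply,
      Fin.cons_succ, Fin.val_castSucc]
    rw [pow_sub_mul_pow_eq_sum _ _ this]
    simp [S]
  rw [h0, hsub, Matrix.det_mul_row (fun i : Fin n => x i - x n) S]
  have hsum : S.det
      = ∑ m ∈ Fintype.piFinset fun k : Fin n => Ico (l k.castSucc) (l k.succ),
        (∏ k : Fin n, x n ^ (l k.succ - 1 - m k)) * alternant x m := by
    have h := (Matrix.detRowAlternating (R := R) (n := Fin n)).toMultilinearMap.map_sum_finset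
      (fun (k : Fin n) m => x n ^ (l k.succ - 1 - m) • fun i : Fin n => x i ^ m)
      (fun k => Ico (l k.castSucc) (l k.succ))
    refine h.trans (sum_congr rfl fun m _ => ?_)
    rw [MultilinearMap.map_smul_univ]
    rfl
  have hsign : (-1 : R) ^ n * ∏ i : Fin n, (x i - x n) = ∏ i ∈ range n, (x n - x i) := by
    have hneg : (-1 : R) ^ n = ∏ _i : Fin n, (-1 : R) := by simp
    rw [prod_range fun i => x n - x i, hneg, ← prod_mul_distrib]
    simp
  rw [hsum, ← hsign]
  simp only [Fin.val_zero, Fin.val_last, zero_add, mul_assoc, ← mul_sum]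
  ring

/-! ### Partitions with at most `n` rows as strictly increasing sequences -/

/-- The increasing sequence `μ_n < μ_{n-1} + 1 < ⋯ < μ_1 + n - 1` attached to a partition
`μ_1 ≥ μ_2 ≥ ⋯`; it determines `μ` if `μ` has at most `n` rows.  As `YoungDiagram.rowLen` numbers
the rows from `0`, the entry with index `k` comes from the row `n - 1 - k`. -/
def shiftedParts (n : ℕ) (μ : YoungDiagram) : Fin n → ℕ :=
  fun k => μ.rowLen k.rev + k

theorem strictMono_shiftedParts (n : ℕ) (μ : YoungDiagram) : StrictMono (shiftedParts n μ) := by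
  intro k k' h
  have h1 : μ.rowLen k.rev ≤ μ.rowLen k'.rev := μ.rowLen_anti _ _ (Fin.rev_lt_rev.2 h).le
  have h2 : (k : ℕ) < k' := h
  simp only [shiftedParts]
  omega

theorem rowLen_eq_zero {μ : YoungDiagram} {i : ℕ} (h : μ.colLen 0 ≤ i) : μ.rowLen i = 0 := by
  by_contra h0
  have h1 : (i, 0) ∈ μ := YoungDiagram.mem_iff_lt_rowLen.2 (Nat.pos_of_ne_zero h0)
  have := YoungDiagram.mem_iff_lt_colLen.1 h1
  omega

theorem colLen_le_of_rowLen_eq_zero {μ : YoungDiagram} {i : ℕ} (h : μ.rowLen i = 0) :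
    μ.colLen 0 ≤ i := by
  by_contra! h0
  have := YoungDiagram.mem_iff_lt_rowLen.1 (YoungDiagram.mem_iff_lt_colLen.2 h0)
  omega

theorem ext_rowLen {μ ν : YoungDiagram} (h : ∀ i, μ.rowLen i = ν.rowLen i) : μ = ν := by
  refine YoungDiagram.ext (Finset.ext fun ⟨i, j⟩ => ?_)
  rw [YoungDiagram.mem_cells, YoungDiagram.mem_cells, YoungDiagram.mem_iff_lt_rowLen,
    YoungDiagram.mem_iff_lt_rowLen, h]

theorem shiftedParts_injOn (n : ℕ) :
    Set.InjOn (shiftedParts n) {μ : YoungDiagram | μ.colLen 0 ≤ n} := by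
  intro μ hμ ν hν h
  refine ext_rowLen fun i => ?_
  rcases lt_or_ge i n with hi | hi
  · have := congrFun h (Fin.rev ⟨i, hi⟩)
    simpa [shiftedParts] using this
  · rw [rowLen_eq_zero (le_trans hμ hi), rowLen_eq_zero (le_trans hν hi)]

theorem exists_rowLen_eq {f : ℕ → ℕ} (hf : Antitone f) {n : ℕ} (h0 : ∀ i, n ≤ i → f i = 0) :
    ∃ μ : YoungDiagram, ∀ i, μ.rowLen i = f i := by
  let μ : YoungDiagram :=
    { cells := {c ∈ range n ×ˢ range (f 0) | c.2 < f c.1}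
      isLowerSet := by
        rintro ⟨i, j⟩ ⟨i', j'⟩ ⟨hi, hj⟩ h
        simp only [coe_filter, mem_product, mem_range, Set.mem_ofPred_eq] at h hi hj ⊢
        have := hf hi
        omega }
  refine ⟨μ, fun i => ?_⟩
  have h (j : ℕ) : j < μ.rowLen i ↔ j < f i := by
    rw [← YoungDiagram.mem_iff_lt_rowLen, ← YoungDiagram.mem_cells]
    simp only [μ, mem_filter, mem_product, mem_range, and_iff_right_iff_imp]
    intro hj
    have h1 := hf (Nat.zero_le i)
    have h2 : i < n := by
      by_contra! h
      have := h0 i h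
      omega
    omega
  have h1 := h (μ.rowLen i)
  have h2 := h (f i)
  omega

/-- Every strictly increasing sequence of length `n` comes from a partition with at most `n`
rows. -/
theorem exists_shiftedParts_eq {n : ℕ} {l : Fin n → ℕ} (hl : StrictMono l) :
    ∃ μ : YoungDiagram, μ.colLen 0 ≤ n ∧ shiftedParts n μ = l := by
  have hadd (k k' : Fin n) (h : k ≤ k') : l k + (k' - k) ≤ l k' := by
    obtain ⟨k', hk'⟩ := k'
    induction k' with
    | zero =>
      have : k = ⟨0, hk'⟩ := le_antisymm h (Nat.zero_le _)
      simp [this]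
    | succ j ih =>
      rcases eq_or_lt_of_le h with rfl | h'
      · simp
      · have h1 : k ≤ ⟨j, by omega⟩ := Nat.lt_succ_iff.1 h'
        have h2 := ih (by omega) h1
        have h3 : l ⟨j, by omega⟩ < l ⟨j + 1, hk'⟩ := hl (Nat.lt_succ_self j)
        have h4 : (k : ℕ) ≤ j := h1
        simp only at h2 ⊢
        omega
  have hle (k : Fin n) : (k : ℕ) ≤ l k := by
    have := hadd ⟨0, by have := k.2; omega⟩ k (Nat.zero_le _)
    simp only at this
    omega
  obtain ⟨μ, hμ⟩ := exists_rowLen_eq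
    (f := fun i => if h : i < n then l (Fin.rev ⟨i, h⟩) - (Fin.rev ⟨i, h⟩ : Fin n) else 0)
    (n := n) (by
      intro i j hij
      by_cases hj : j < n
      · have hi : i < n := lt_of_le_of_lt hij hj
        simp only [hi, hj, dif_pos]
        have := hadd (Fin.rev ⟨j, hj⟩) (Fin.rev ⟨i, hi⟩) (Fin.rev_le_rev.2 hij)
        have h2 := hle (Fin.rev ⟨j, hj⟩)
        simp only [Fin.val_rev] at this h2 ⊢
        omega
      · simp [hj])
    (by
      intro i hi
      simp [hi.not_gt])
  refine ⟨μ, colLen_le_of_rowLen_eq_zero ?_, ?_⟩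
  · rw [hμ]
    simp
  · ext k
    have := hle k
    simp only [shiftedParts, hμ, Fin.is_lt, dif_pos, Fin.eta, Fin.rev_rev]
    omega

theorem card_eq_sum_rowLen {μ : YoungDiagram} {n : ℕ} (h : μ.colLen 0 ≤ n) :
    μ.card = ∑ i ∈ range n, μ.rowLen i := by
  have hmap : ∀ c ∈ μ.cells, c.1 ∈ range n := by
    rintro ⟨i, j⟩ hc
    have h1 := YoungDiagram.mem_iff_lt_colLen.1
      (μ.up_left_mem le_rfl (Nat.zero_le j) ((YoungDiagram.mem_cells _).1 hc))
    exact mem_range.2 (lt_of_lt_of_le h1 h)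
  rw [YoungDiagram.card, card_eq_sum_card_fiberwise hmap]
  refine sum_congr rfl fun i _ => ?_
  rw [YoungDiagram.rowLen_eq_card]
  rfl

theorem card_eq_sum_rowLen_rev {μ : YoungDiagram} {n : ℕ} (h : μ.colLen 0 ≤ n) :
    μ.card = ∑ k : Fin n, μ.rowLen k.rev := by
  rw [card_eq_sum_rowLen h, sum_range]
  exact (Equiv.sum_comp Fin.revPerm fun k : Fin n => μ.rowLen k).symm

theorem sum_shiftedParts {μ : YoungDiagram} {n : ℕ} (h : μ.colLen 0 ≤ n) :
    ∑ k, shiftedParts n μ k = μ.card + ∑ k ∈ range n, k := by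
  rw [card_eq_sum_rowLen_rev h, sum_range fun k => k, ← sum_add_distrib]
  rfl

/-! ### Schur polynomials -/

theorem finite_boundedTableaux (n : ℕ) (μ : YoungDiagram) :
    {T : SemistandardYoungTableau μ | ∀ i j, (i, j) ∈ μ → T i j < n}.Finite := by
  refine Set.Finite.of_injOn (f := fun T (c : μ.cells) => T c.1.1 c.1.2)
    (t := Set.univ.pi fun _ => Set.Iio n) ?_ ?_ (Set.Finite.pi fun _ => Set.finite_Iio n)
  · rintro T hT c -
    exact hT _ _ ((YoungDiagram.mem_cells _).1 c.2)
  · intro T _ T' _ hT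
    ext i j
    by_cases hij : (i, j) ∈ μ
    · exact congrFun hT ⟨(i, j), (YoungDiagram.mem_cells _).2 hij⟩
    · rw [T.zeros hij, T'.zeros hij]

/-- The semistandard tableaux of shape `μ` with entries in `{0, …, n - 1}`. -/
noncomputable def boundedTableaux (n : ℕ) (μ : YoungDiagram) :
    Finset (SemistandardYoungTableau μ) :=
  (finite_boundedTableaux n μ).toFinset

theorem mem_boundedTableaux {n : ℕ} {μ : YoungDiagram} {T : SemistandardYoungTableau μ} :
    T ∈ boundedTableaux n μ ↔ ∀ i j, (i, j) ∈ μ → T i j < n := by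
  simp [boundedTableaux]

/-- The Schur polynomial `s_μ(x_0, …, x_{n-1})`. -/
noncomputable def schurPoly {R : Type*} [CommRing R] (x : ℕ → R) (n : ℕ) (μ : YoungDiagram) : R :=
  ∑ T ∈ boundedTableaux n μ, ∏ c ∈ μ.cells, x (T c.1 c.2)

theorem le_entry {μ : YoungDiagram} (T : SemistandardYoungTableau μ) {i j : ℕ}
    (h : (i, j) ∈ μ) : i ≤ T i j := by
  induction i with
  | zero => exact Nat.zero_le _
  | succ i ih =>
    have h1 := ih (μ.up_left_mem (Nat.le_succ i) le_rfl h)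
    have h2 := T.col_strict (Nat.lt_add_one i) h
    omega

theorem colLen_le_of_mem_boundedTableaux {n : ℕ} {μ : YoungDiagram}
    {T : SemistandardYoungTableau μ} (h : T ∈ boundedTableaux n μ) : μ.colLen 0 ≤ n := by
  by_contra! hn
  have hm : (n, 0) ∈ μ := YoungDiagram.mem_iff_lt_colLen.2 hn
  have h1 := mem_boundedTableaux.1 h n 0 hm
  have h2 := le_entry T hm
  omega

theorem schurPoly_eq_zero {R : Type*} [CommRing R] (x : ℕ → R) {n : ℕ} {μ : YoungDiagram}
    (h : n < μ.colLen 0) : schurPoly x n μ = 0 :=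
  sum_eq_zero fun _ hT => absurd (colLen_le_of_mem_boundedTableaux hT) h.not_ge

/-- The restriction of a tableau to a smaller shape. -/
def restrictTableau {μ ν : YoungDiagram} (h : ν ≤ μ) (T : SemistandardYoungTableau μ) :
    SemistandardYoungTableau ν where
  entry i j := if (i, j) ∈ ν then T i j else 0
  row_weak' := by
    intro i j1 j2 hj hm
    rw [if_pos hm, if_pos (ν.up_left_mem le_rfl hj.le hm)]
    exact T.row_weak hj (h hm)
  col_strict' := by
    intro i1 i2 j hi hm
    rw [if_pos hm, if_pos (ν.up_left_mem hi.le le_rfl hm)]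
    exact T.col_strict hi (h hm)
  zeros' := by
    intro i j hm
    rw [if_neg hm]

theorem restrictTableau_apply {μ ν : YoungDiagram} (h : ν ≤ μ) (T : SemistandardYoungTableau μ)
    {i j : ℕ} (hm : (i, j) ∈ ν) : restrictTableau h T i j = T i j :=
  if_pos hm

/-- The shape formed by the entries smaller than `n` of a tableau. -/
def sublevelShape (n : ℕ) {μ : YoungDiagram} (T : SemistandardYoungTableau μ) : YoungDiagram where
  cells := {c ∈ μ.cells | T c.1 c.2 < n}
  isLowerSet := by
    rintro ⟨i, j⟩ ⟨i', j'⟩ ⟨hi, hj⟩ h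
    simp only [coe_filter, Set.mem_ofPred_eq, YoungDiagram.mem_cells] at h hi hj ⊢
    refine ⟨μ.up_left_mem hi hj h.1, ?_⟩
    have h1 := T.row_weak_of_le hj (μ.up_left_mem hi le_rfl h.1)
    have h2 := T.col_weak hi h.1
    omega

theorem mem_sublevelShape {n : ℕ} {μ : YoungDiagram} {T : SemistandardYoungTableau μ} {i j : ℕ} :
    (i, j) ∈ sublevelShape n T ↔ (i, j) ∈ μ ∧ T i j < n := by
  rw [← YoungDiagram.mem_cells, sublevelShape, mem_filter, YoungDiagram.mem_cells]

/-- The partition `ν` interlaces `μ`: `μ_1 ≥ ν_1 ≥ μ_2 ≥ ν_2 ≥ ⋯`, in other words `μ / ν` is a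
horizontal strip. -/
def Interlaces (ν μ : YoungDiagram) : Prop :=
  ∀ i, μ.rowLen (i + 1) ≤ ν.rowLen i ∧ ν.rowLen i ≤ μ.rowLen i

theorem Interlaces.le {ν μ : YoungDiagram} (h : Interlaces ν μ) : ν ≤ μ := by
  rintro ⟨i, j⟩ hm
  exact YoungDiagram.mem_iff_lt_rowLen.2
    ((YoungDiagram.mem_iff_lt_rowLen.1 hm).trans_le (h i).2)

theorem interlaces_sublevelShape {n : ℕ} {μ : YoungDiagram} {T : SemistandardYoungTableau μ}
    (hT : T ∈ boundedTableaux (n + 1) μ) : Interlaces (sublevelShape n T) μ := by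
  rw [mem_boundedTableaux] at hT
  refine fun i => ⟨le_of_forall_lt fun j hj => ?_, le_of_forall_lt fun j hj => ?_⟩
  · rw [← YoungDiagram.mem_iff_lt_rowLen] at hj ⊢
    have h1 := T.col_strict (Nat.lt_add_one i) hj
    have h2 := hT _ _ hj
    exact mem_sublevelShape.2 ⟨μ.up_left_mem (Nat.le_succ i) le_rfl hj, by omega⟩
  · rw [← YoungDiagram.mem_iff_lt_rowLen] at hj ⊢
    exact (mem_sublevelShape.1 hj).1

theorem colLen_sublevelShape_le (n : ℕ) {μ : YoungDiagram} (T : SemistandardYoungTableau μ) :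
    (sublevelShape n T).colLen 0 ≤ n := by
  by_contra! hn
  have hm := mem_sublevelShape.1 (YoungDiagram.mem_iff_lt_colLen.2 hn)
  have := le_entry T hm.1
  omega

/-- Filling the horizontal strip `μ / ν` with the entry `n` extends a tableau of shape `ν` with
smaller entries to a tableau of shape `μ`. -/
def extendTableau {n : ℕ} {μ ν : YoungDiagram} (h : Interlaces ν μ)
    (T : SemistandardYoungTableau ν) (hT : T ∈ boundedTableaux n ν) :
    SemistandardYoungTableau μ where
  entry i j := if (i, j) ∈ ν then T i j else if (i, j) ∈ μ then n else 0
  row_weak' := by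
    intro i j1 j2 hj hm
    have hb := mem_boundedTableaux.1 hT
    by_cases h2 : (i, j2) ∈ ν
    · rw [if_pos h2, if_pos (ν.up_left_mem le_rfl hj.le h2)]
      exact T.row_weak hj h2
    · rw [if_neg h2, if_pos hm, if_pos (μ.up_left_mem le_rfl hj.le hm)]
      split_ifs with h1
      · exact (hb _ _ h1).le
      · exact le_rfl
  col_strict' := by
    intro i1 i2 j hi hm
    have hb := mem_boundedTableaux.1 hT
    -- the cells of a horizontal strip lie in different columns
    have h1 : (i1, j) ∈ ν := by
      rw [YoungDiagram.mem_iff_lt_rowLen] at hm ⊢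
      have := μ.rowLen_anti (i1 + 1) i2 hi
      have := (h i1).1
      omega
    rw [if_pos h1, if_pos hm]
    split_ifs with h2
    · exact T.col_strict hi h2
    · exact hb _ _ h1
  zeros' := by
    intro i j hm
    rw [if_neg fun h' => hm (h.le h'), if_neg hm]

theorem extendTableau_apply {n : ℕ} {μ ν : YoungDiagram} (h : Interlaces ν μ)
    (T : SemistandardYoungTableau ν) (hT : T ∈ boundedTableaux n ν) (i j : ℕ) :
    extendTableau h T hT i j = if (i, j) ∈ ν then T i j else if (i, j) ∈ μ then n else 0 :=
  rfl

open scoped Classical in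
/-- The tableaux of shape `μ` whose entries smaller than `n` fill the shape `ν` are the extensions
of the tableaux of shape `ν` by a horizontal strip of entries `n`. -/
theorem sum_sublevelShape_eq {R : Type*} [CommRing R] (x : ℕ → R) {n : ℕ} {μ ν : YoungDiagram}
    (h : Interlaces ν μ) :
    ∑ T ∈ boundedTableaux (n + 1) μ with sublevelShape n T = ν, ∏ c ∈ μ.cells, x (T c.1 c.2) =
      x n ^ #(μ.cells \ ν.cells) * schurPoly x n ν := by
  have hval : ∀ T ∈ {T ∈ boundedTableaux (n + 1) μ | sublevelShape n T = ν}, ∀ i j, (i, j) ∈ μ →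
      (i, j) ∉ ν → T i j = n := by
    intro T hT i j hm hn
    obtain ⟨hT', rfl⟩ := mem_filter.1 hT
    have h1 := mem_boundedTableaux.1 hT' i j hm
    have h2 : ¬ T i j < n := fun h2 => hn (mem_sublevelShape.2 ⟨hm, h2⟩)
    omega
  rw [schurPoly, mul_sum]
  refine sum_nbij (restrictTableau h.le) ?_ ?_ ?_ ?_
  · intro T hT
    obtain ⟨hT, rfl⟩ := mem_filter.1 hT
    rw [mem_boundedTableaux]
    intro i j hm
    rw [restrictTableau_apply _ _ hm]
    exact (mem_sublevelShape.1 hm).2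
  · intro T hT T' hT' he
    ext i j
    by_cases hm : (i, j) ∈ μ
    · by_cases hn : (i, j) ∈ ν
      · rw [← restrictTableau_apply h.le T hn, he, restrictTableau_apply _ _ hn]
      · rw [hval T hT i j hm hn, hval T' hT' i j hm hn]
    · rw [T.zeros hm, T'.zeros hm]
  · intro T hT
    have hb := mem_boundedTableaux.1 hT
    refine ⟨extendTableau h T hT, ?_, ?_⟩
    · simp only [coe_filter, Set.mem_ofPred_eq]
      constructor
      · rw [mem_boundedTableaux]
        intro i j hm
        rw [extendTableau_apply, if_pos hm]
        split_ifs with h1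
        · exact (hb _ _ h1).trans (Nat.lt_succ_self n)
        · exact Nat.lt_succ_self n
      · refine YoungDiagram.ext (Finset.ext fun ⟨i, j⟩ => ?_)
        rw [YoungDiagram.mem_cells, YoungDiagram.mem_cells, mem_sublevelShape, extendTableau_apply]
        constructor
        · rintro ⟨hm, hlt⟩
          by_contra h1
          simp [h1, hm] at hlt
        · intro h1
          rw [if_pos h1]
          exact ⟨h.le h1, hb _ _ h1⟩
    · ext i j
      by_cases hn : (i, j) ∈ ν
      · rw [restrictTableau_apply _ _ hn, extendTableau_apply, if_pos hn]
      · rw [SemistandardYoungTableau.zeros _ hn, T.zeros hn]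
  · intro T hT
    have hsub : ν.cells ⊆ μ.cells := h.le
    rw [← prod_sdiff hsub, ← prod_const]
    congr 1
    · refine prod_congr rfl fun c hc => ?_
      rw [Finset.mem_sdiff, YoungDiagram.mem_cells, YoungDiagram.mem_cells] at hc
      rw [hval T hT c.1 c.2 hc.1 hc.2]
    · refine prod_congr rfl fun c hc => ?_
      rw [restrictTableau_apply _ _ ((YoungDiagram.mem_cells _).1 hc)]

theorem shiftedParts_castSucc (n : ℕ) (μ : YoungDiagram) (k : Fin n) :
    shiftedParts (n + 1) μ k.castSucc = μ.rowLen (k.rev + 1) + k := by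
  rw [shiftedParts, Fin.rev_castSucc]
  rfl

theorem shiftedParts_succ (n : ℕ) (μ : YoungDiagram) (k : Fin n) :
    shiftedParts (n + 1) μ k.succ = μ.rowLen k.rev + k + 1 := by
  rw [shiftedParts, Fin.rev_succ]
  rfl

theorem interlaces_iff_shiftedParts_mem {n : ℕ} {μ ν : YoungDiagram} (hμ : μ.colLen 0 ≤ n + 1)
    (hν : ν.colLen 0 ≤ n) :
    Interlaces ν μ ↔ shiftedParts n ν ∈ Fintype.piFinset fun k : Fin n =>
      Ico (shiftedParts (n + 1) μ k.castSucc) (shiftedParts (n + 1) μ k.succ) := by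
  simp only [Fintype.mem_piFinset, mem_Ico, shiftedParts_castSucc, shiftedParts_succ]
  constructor
  · intro h k
    have := h k.rev
    simp only [shiftedParts]
    omega
  · intro h i
    rcases lt_or_ge i n with hi | hi
    · have := h (Fin.rev ⟨i, hi⟩)
      simp only [shiftedParts, Fin.rev_rev] at this
      omega
    · rw [rowLen_eq_zero (hν.trans hi), rowLen_eq_zero (hμ.trans (Nat.succ_le_succ hi))]
      simp

theorem card_sdiff_of_interlaces {n : ℕ} {μ ν : YoungDiagram} (hμ : μ.colLen 0 ≤ n + 1)
    (hν : ν.colLen 0 ≤ n) (h : Interlaces ν μ) :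
    #(μ.cells \ ν.cells) = shiftedParts (n + 1) μ 0 +
      ∑ k : Fin n, (shiftedParts (n + 1) μ k.succ - 1 - shiftedParts n ν k) := by
  have hsub : ν.cells ⊆ μ.cells := h.le
  have h1 := card_sdiff_add_card_eq_card hsub
  have h2 : #μ.cells = ∑ k : Fin (n + 1), μ.rowLen k.rev := card_eq_sum_rowLen_rev hμ
  have h3 : #ν.cells = ∑ k : Fin n, ν.rowLen k.rev := card_eq_sum_rowLen_rev hν
  rw [Fin.sum_univ_succ] at h2
  have h4 : ∑ k : Fin n, μ.rowLen (k.succ.rev) =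
      ∑ k : Fin n, (shiftedParts (n + 1) μ k.succ - 1 - shiftedParts n ν k) +
        ∑ k : Fin n, ν.rowLen k.rev := by
    rw [← sum_add_distrib]
    refine sum_congr rfl fun k _ => ?_
    have := (h k.rev).2
    rw [shiftedParts_succ, shiftedParts, Fin.rev_succ, Fin.val_castSucc]
    omega
  have h5 : shiftedParts (n + 1) μ 0 = μ.rowLen (0 : Fin (n + 1)).rev := by simp [shiftedParts]
  omega

/-- The **bialternant formula** for Schur polynomials: both sides satisfy the same branching
rule. -/
theorem vandermondeProd_mul_schurPoly {R : Type*} [CommRing R] (x : ℕ → R) {n : ℕ}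
    {μ : YoungDiagram} (hμ : μ.colLen 0 ≤ n) :
    vandermondeProd x n * schurPoly x n μ = alternant x (shiftedParts n μ) := by
  induction n generalizing μ with
  | zero =>
    have hcells : μ.cells = ∅ := by
      have : μ = ⊥ := ext_rowLen fun i => by
        rw [rowLen_eq_zero (hμ.trans (Nat.zero_le i)), rowLen_eq_zero]
        exact colLen_le_of_rowLen_eq_zero (by simp [YoungDiagram.rowLen_eq_card, YoungDiagram.row])
      rw [this, YoungDiagram.cells_bot]
    have hb : boundedTableaux 0 μ = {SemistandardYoungTableau.highestWeight μ} := by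
      have hmem (i j : ℕ) : (i, j) ∉ μ := by
        rw [← YoungDiagram.mem_cells, hcells]
        simp
      ext T
      rw [mem_boundedTableaux, mem_singleton]
      refine ⟨fun _ => ?_, fun _ i j h => absurd h (hmem i j)⟩
      ext i j
      rw [T.zeros (hmem i j), SemistandardYoungTableau.zeros _ (hmem i j)]
    simp [vandermondeProd, schurPoly, alternant, hb, hcells]
  | succ n ih =>
    classical
    rw [alternant_succ x (strictMono_shiftedParts (n + 1) μ).monotone, vandermondeProd_succ,
      schurPoly, ← sum_fiberwise_of_maps_to (g := fun T => shiftedParts n (sublevelShape n T))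
        (fun T hT => (interlaces_iff_shiftedParts_mem hμ (colLen_sublevelShape_le n T)).1
          (interlaces_sublevelShape hT)), mul_comm (vandermondeProd x n), mul_assoc, mul_sum]
    congr 1
    refine sum_congr rfl fun m hm => ?_
    have hmono : StrictMono m := by
      intro k k' hk
      rw [Fintype.mem_piFinset] at hm
      have h1 := (mem_Ico.1 (hm k)).2
      have h2 := (mem_Ico.1 (hm k')).1
      have h3 : shiftedParts (n + 1) μ k.succ ≤ shiftedParts (n + 1) μ k'.castSucc :=
        (strictMono_shiftedParts (n + 1) μ).monotone hk
      omega
    obtain ⟨ν, hν, rfl⟩ := exists_shiftedParts_eq hmono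
    have hint := (interlaces_iff_shiftedParts_mem hμ hν).2 hm
    have hfilter : {T ∈ boundedTableaux (n + 1) μ |
        shiftedParts n (sublevelShape n T) = shiftedParts n ν} =
        {T ∈ boundedTableaux (n + 1) μ | sublevelShape n T = ν} :=
      filter_congr fun T _ =>
        (shiftedParts_injOn n).eq_iff (colLen_sublevelShape_le n T) hν
    rw [hfilter, sum_sublevelShape_eq x hint, ← ih hν, card_sdiff_of_interlaces hμ hν hint,
      pow_add, prod_pow_eq_pow_sum]
    ring

/-! ### The principal specialization -/

/-- The variables `q^ρ = (q^{1/2}, q^{3/2}, …)`, as complex numbers. -/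
noncomputable def rhoVar (q : ℝ) (m : ℕ) : ℂ :=
  ((q ^ ((m : ℝ) + 1 / 2) : ℝ) : ℂ)

theorem rhoVar_succ {q : ℝ} (hq : 0 < q) (m : ℕ) : rhoVar q (m + 1) = q * rhoVar q m := by
  rw [rhoVar, rhoVar, ← Complex.ofReal_mul, ← Real.rpow_one_add' hq.le (by positivity)]
  push_cast
  ring_nf

theorem rhoVar_eq {q : ℝ} (hq : 0 < q) (m : ℕ) : rhoVar q m = q ^ m * rhoVar q 0 := by
  induction m with
  | zero => simp
  | succ m ih => rw [rhoVar_succ hq, ih]; ring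

theorem rhoVar_injective {q : ℝ} (hq : 0 < q) (hq' : q < 1) : Function.Injective (rhoVar q) := by
  intro m m' h
  have h1 := Complex.ofReal_injective h
  have h2 := (Real.rpow_right_inj hq hq'.ne).1 h1
  exact_mod_cast add_right_cancel h2

theorem vandermondeProd_rhoVar_ne_zero {q : ℝ} (hq : 0 < q) (hq' : q < 1) (n : ℕ) :
    vandermondeProd (rhoVar q) n ≠ 0 := by
  refine prod_ne_zero_iff.2 fun k _ => prod_ne_zero_iff.2 fun i hi => sub_ne_zero.2 fun h => ?_
  have := rhoVar_injective hq hq' h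
  have := mem_range.1 hi
  omega

/-- The Vandermonde products of a geometric progression satisfy a three-term relation. -/
theorem vandermondeProd_rhoVar_mul {q : ℝ} (hq : 0 < q) (n : ℕ) :
    vandermondeProd (rhoVar q) (n + 2) * vandermondeProd (rhoVar q) n =
      -(vandermondeProd (rhoVar q) (n + 1) ^ 2 * (q : ℂ) ^ n *
        (rhoVar q 0 * (1 - (q : ℂ) ^ (n + 1)))) := by
  have h : ∏ i ∈ range (n + 1), (rhoVar q (n + 1) - rhoVar q i) =
      (q : ℂ) ^ n * (∏ i ∈ range n, (rhoVar q n - rhoVar q i)) *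
        (rhoVar q (n + 1) - rhoVar q 0) := by
    rw [prod_range_succ']
    congr 1
    have hn : (q : ℂ) ^ n = ∏ _i ∈ range n, (q : ℂ) := by simp
    rw [hn, ← prod_mul_distrib]
    refine prod_congr rfl fun i _ => ?_
    rw [rhoVar_succ hq, rhoVar_succ hq]
    ring
  rw [vandermondeProd_succ _ (n + 1), h, rhoVar_eq hq (n + 1)]
  have h1 := vandermondeProd_succ (rhoVar q) n
  linear_combination -(q : ℂ) ^ n * (rhoVar q 0 * (1 - (q : ℂ) ^ (n + 1))) *
    vandermondeProd (rhoVar q) (n + 1) * (-h1)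

/-- The tableaux with entries smaller than `n` exhaust all tableaux. -/
theorem tendsto_schurPoly {q : ℝ} (hq : 0 < q) (hq' : q < 1) (μ : YoungDiagram) :
    Tendsto (fun n => schurPoly (rhoVar q) n μ) atTop (𝓝 (schurRho q μ : ℂ)) := by
  have h1 : Tendsto (fun n => boundedTableaux n μ) atTop atTop := by
    refine tendsto_atTop_finset_of_monotone ?_ ?_
    · intro n n' h T hT
      rw [mem_boundedTableaux] at hT ⊢
      exact fun i j hm => (hT i j hm).trans_le h
    · intro T
      refine ⟨(μ.cells.sup fun c => T c.1 c.2) + 1, mem_boundedTableaux.2 fun i j hm => ?_⟩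
      exact Nat.lt_succ_of_le
        (le_sup (f := fun c : ℕ × ℕ => T c.1 c.2) ((YoungDiagram.mem_cells _).2 hm))
  have h2 := (summable_tableauWeight hq hq' μ).hasSum
  rw [HasSum, SummationFilter.unconditional_filter] at h2
  have h3 := (Complex.continuous_ofReal.tendsto _).comp (h2.comp h1)
  refine h3.congr fun n => ?_
  simp only [Function.comp, schurPoly, tableauWeight, rhoVar]
  push_cast
  rfl

/-! ### The potential as a sum over occupied positions -/

theorem colLen_bot : (⊥ : YoungDiagram).colLen 0 = 0 := by
  simp [YoungDiagram.colLen_eq_card, YoungDiagram.col]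

theorem potential_bot (q : ℝ) (k : ℕ+) (p : ℤ) :
    potential q k ⊥ p = q ^ (k : ℤ) * (1 - q ^ (p * (k : ℤ))) / (1 - q ^ (k : ℤ)) := by
  simp [potential, colLen_bot]

theorem potential_bot_add {q : ℝ} (hq : 0 < q) (hq' : q < 1) (k : ℕ+) (p : ℤ) :
    q ^ ((k : ℤ) * p) + potential q k ⊥ (p - 1) = potential q k ⊥ p := by
  have h1 : (1 : ℝ) - q ^ (k : ℤ) ≠ 0 := by
    rw [zpow_natCast]
    exact sub_ne_zero.2 (pow_lt_one₀ hq.le hq' k.ne_zero).ne'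
  have h2 : q ^ (p * (k : ℤ)) = q ^ ((p - 1) * (k : ℤ)) * q ^ (k : ℤ) := by
    rw [← zpow_add₀ hq.ne']
    ring_nf
  rw [potential_bot, potential_bot, mul_comm (k : ℤ) p, h2]
  field_simp
  ring

theorem potential_bot_eq_sum {q : ℝ} (hq : 0 < q) (hq' : q < 1) (k : ℕ+) (p : ℤ) (n : ℕ) :
    ∑ i ∈ range n, q ^ ((k : ℤ) * (p - (i : ℤ))) + potential q k ⊥ (p - n) =
      potential q k ⊥ p := by
  induction n with
  | zero => simp
  | succ n ih =>
    rw [sum_range_succ, ← ih, ← potential_bot_add hq hq' k (p - n)]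
    push_cast
    rw [sub_sub]
    ring

/-- The potential of a partition with at most `n` rows is the sum of `q ^ (k * s)` over the `n`
highest occupied positions `s = p + μ_i - i`, plus the potential of the vacuum of charge
`p - n`. -/
theorem potential_eq_sum {q : ℝ} (hq : 0 < q) (hq' : q < 1) (k : ℕ+) {μ : YoungDiagram} (p : ℤ)
    {n : ℕ} (hμ : μ.colLen 0 ≤ n) :
    potential q k μ p = ∑ i ∈ range n, q ^ ((k : ℤ) * (p + (μ.rowLen i : ℤ) - (i : ℤ))) +
      potential q k ⊥ (p - n) := by
  have h : ∑ i ∈ range (μ.colLen 0),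
      (q ^ ((k : ℤ) * (p + (μ.rowLen i : ℤ) - (i : ℤ))) - q ^ ((k : ℤ) * (p - (i : ℤ)))) =
      ∑ i ∈ range n,
      (q ^ ((k : ℤ) * (p + (μ.rowLen i : ℤ) - (i : ℤ))) - q ^ ((k : ℤ) * (p - (i : ℤ)))) := by
    refine sum_subset (range_mono hμ) fun i _ hi => ?_
    rw [rowLen_eq_zero (not_lt.1 fun h => hi (mem_range.2 h))]
    simp
  have h1 := potential_bot_eq_sum hq hq' k p n
  rw [potential, h, ← potential_bot, ← h1, sum_sub_distrib]
  ring

/-- The Boltzmann factor `exp (∑ t_k q ^ (k * s))` of the position `s`. -/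
noncomputable def siteWeight (q : ℝ) (t : ℕ+ → ℂ) (s : ℤ) : ℂ :=
  Complex.exp (∑' k : ℕ+, t k * ((q ^ ((k : ℤ) * s) : ℝ) : ℂ))

/-- The factor `e^{Φ(t,μ,p)}` is the product of the weights of the `n` highest occupied sites
`p - n + 1 + l`, where `l` runs through `shiftedParts n μ`, and of the factor of the vacuum of
charge `p - n`. -/
theorem exp_totalPotential {q : ℝ} (hq : 0 < q) (hq' : q < 1) {t : ℕ+ → ℂ} (ht : Admissible q t)
    {μ : YoungDiagram} (p : ℤ) {n : ℕ} (hμ : μ.colLen 0 ≤ n) :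
    Complex.exp (totalPotential q t μ p) = Complex.exp (totalPotential q t ⊥ (p - n)) *
      ∏ k : Fin n, siteWeight q t (p - n + 1 + (shiftedParts n μ k : ℕ)) := by
  have hs (s : ℤ) : Summable fun k : ℕ+ => t k * ((q ^ ((k : ℤ) * s) : ℝ) : ℂ) := by
    refine ((ht ⊥ s).sub (ht ⊥ (s - 1))).congr fun k => ?_
    rw [← potential_bot_add hq hq' k s]
    push_cast
    ring
  have hsum : totalPotential q t μ p = totalPotential q t ⊥ (p - n) +
      ∑ i ∈ range n, ∑' k : ℕ+, t k * ((q ^ ((k : ℤ) * (p + (μ.rowLen i : ℤ) - (i : ℤ))) : ℝ) : ℂ)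
      := by
    rw [totalPotential, totalPotential, ← Summable.tsum_finsetSum fun i _ => hs _,
      ← (ht ⊥ (p - n)).tsum_add (summable_sum fun i _ => hs _)]
    refine tsum_congr fun k => ?_
    rw [potential_eq_sum hq hq' k p hμ, ← mul_sum]
    push_cast
    ring
  rw [hsum, Complex.exp_add, Complex.exp_sum, prod_range]
  congr 1
  rw [← Equiv.prod_comp Fin.revPerm]
  refine prod_congr rfl fun k _ => ?_
  have hk : p + (μ.rowLen (Fin.revPerm k : Fin n) : ℤ) - ((Fin.revPerm k : Fin n) : ℕ) =
      p - n + 1 + (shiftedParts n μ k : ℕ) := by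
    have := k.2
    simp only [Fin.revPerm_apply, shiftedParts, Fin.val_rev]
    omega
  rw [hk, siteWeight]

/-! ### The truncated partition functions -/

/-- The series `∑_μ s_μ s_μ e^{Φ(t,μ,p)} X^{|μ|}` with the Schur functions replaced by the Schur
polynomials in the first `n` variables.  The vacuum energy `p(p+1)/2` is left out. -/
noncomputable def truncatedZ (q₁ q₂ q : ℝ) (t : ℕ+ → ℂ) (n : ℕ) (p : ℤ) : PowerSeries ℂ :=
  PowerSeries.mk fun e => ∑ μ ∈ (finite_energy_eq 0 e).toFinset,
    schurPoly (rhoVar q₁) n μ * schurPoly (rhoVar q₂) n μ * Complex.exp (totalPotential q t μ p)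

/-- The determinant of the `n × n` matrix with entries `∑ h_m (x_i y_j X)^m`, where `x = q₁^ρ` and
`y = q₂^ρ`. -/
noncomputable def momentDet (q₁ q₂ : ℝ) (h : ℕ → ℂ) (n : ℕ) : PowerSeries ℂ :=
  (Matrix.of fun i j : Fin n => PowerSeries.mk fun m =>
    h m * rhoVar q₁ i ^ m * rhoVar q₂ j ^ m).det

theorem mem_finite_energy_zero {e : ℕ} {μ : YoungDiagram} :
    μ ∈ (finite_energy_eq 0 e).toFinset ↔ μ.card = e := by
  simp [energy]

/-- Cauchy–Binet and the bialternant formula express the truncated partition function as a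
determinant.  The exponent `∑ k ∈ range n, k` is the sum of the sequence attached to the empty
partition. -/
theorem momentDet_eq_truncatedZ (q₁ q₂ : ℝ) {q : ℝ} (hq : 0 < q) (hq' : q < 1) {t : ℕ+ → ℂ}
    (ht : Admissible q t) (n : ℕ) (p : ℤ) :
    PowerSeries.C (Complex.exp (totalPotential q t ⊥ (p - n))) *
        momentDet q₁ q₂ (fun m => siteWeight q t (p - n + 1 + m)) n =
      PowerSeries.C (vandermondeProd (rhoVar q₁) n * vandermondeProd (rhoVar q₂) n) *
        (PowerSeries.X ^ (∑ k ∈ range n, k) * truncatedZ q₁ q₂ q t n p) := by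
  ext d
  rw [PowerSeries.coeff_C_mul, PowerSeries.coeff_C_mul, momentDet, coeff_det_mk,
    PowerSeries.coeff_X_pow_mul']
  split_ifs with hd
  · have hfilter : PowerSeries.coeff (d - ∑ k ∈ range n, k) (truncatedZ q₁ q₂ q t n p) =
        ∑ μ ∈ (finite_energy_eq 0 (d - ∑ k ∈ range n, k)).toFinset with μ.colLen 0 ≤ n,
          schurPoly (rhoVar q₁) n μ * schurPoly (rhoVar q₂) n μ *
            Complex.exp (totalPotential q t μ p) := by
      rw [truncatedZ, PowerSeries.coeff_mk]
      refine (sum_filter_of_ne fun μ _ h => ?_).symm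
      by_contra! hn
      exact h (by rw [schurPoly_eq_zero _ hn]; ring)
    rw [hfilter, mul_sum, mul_sum]
    symm
    refine sum_nbij (shiftedParts n) ?_ ?_ ?_ ?_
    · intro μ hμ
      rw [mem_filter, mem_finite_energy_zero] at hμ
      rw [mem_strictMonoSeqs, sum_shiftedParts hμ.2, hμ.1]
      exact ⟨Nat.sub_add_cancel hd, strictMono_shiftedParts n μ⟩
    · refine (shiftedParts_injOn n).mono fun μ hμ => ?_
      exact (mem_filter.1 hμ).2
    · intro l hl
      obtain ⟨h1, h2⟩ := mem_strictMonoSeqs.1 hl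
      obtain ⟨μ, hμ, rfl⟩ := exists_shiftedParts_eq h2
      refine ⟨μ, mem_filter.2 ⟨mem_finite_energy_zero.2 ?_, hμ⟩, rfl⟩
      rw [sum_shiftedParts hμ] at h1
      omega
    · intro μ hμ
      have hμ' := (mem_filter.1 hμ).2
      have h1 := vandermondeProd_mul_schurPoly (rhoVar q₁) hμ'
      have h2 := vandermondeProd_mul_schurPoly (rhoVar q₂) hμ'
      simp only [alternant] at h1 h2
      rw [exp_totalPotential hq hq' ht p hμ', ← h1, ← h2]
      ring
  · rw [mul_zero, sum_eq_zero, mul_zero]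
    intro l hl
    obtain ⟨h1, h2⟩ := mem_strictMonoSeqs.1 hl
    obtain ⟨μ, hμ, rfl⟩ := exists_shiftedParts_eq h2
    rw [sum_shiftedParts hμ] at h1
    omega

/-- The Desnanot–Jacobi identity for the moment determinants: as the variables form geometric
progressions, deleting the first row or the first column amounts to rescaling `X`. -/
theorem momentDet_desnanot_jacobi {q₁ q₂ : ℝ} (hq₁ : 0 < q₁) (hq₂ : 0 < q₂) (h : ℕ → ℂ) (n : ℕ) :
    momentDet q₁ q₂ h (n + 2) *
        PowerSeries.rescale ((q₁ * q₂ : ℝ) : ℂ) (momentDet q₁ q₂ h n) =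
      PowerSeries.rescale ((q₁ * q₂ : ℝ) : ℂ) (momentDet q₁ q₂ h (n + 1)) *
          momentDet q₁ q₂ h (n + 1) -
        PowerSeries.rescale (q₁ : ℂ) (momentDet q₁ q₂ h (n + 1)) *
          PowerSeries.rescale (q₂ : ℂ) (momentDet q₁ q₂ h (n + 1)) := by
  let M (N : ℕ) : Matrix (Fin N) (Fin N) (PowerSeries ℂ) := Matrix.of fun i j =>
    PowerSeries.mk fun m => h m * rhoVar q₁ i ^ m * rhoVar q₂ j ^ m
  have h1 : (M (n + 2)).submatrix Fin.succ Fin.succ =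
      (PowerSeries.rescale ((q₁ * q₂ : ℝ) : ℂ)).mapMatrix (M (n + 1)) := by
    ext i j m
    simp only [M, Matrix.submatrix_apply, Matrix.of_apply, PowerSeries.coeff_mk, Fin.val_succ,
      RingHom.mapMatrix_apply, Matrix.map_apply, PowerSeries.coeff_rescale, rhoVar_succ hq₁,
      rhoVar_succ hq₂, mul_pow, Complex.ofReal_mul]
    ring
  have h2 : (M (n + 2)).submatrix Fin.succ Fin.castSucc =
      (PowerSeries.rescale (q₁ : ℂ)).mapMatrix (M (n + 1)) := by
    ext i j m
    simp only [M, Matrix.submatrix_apply, Matrix.of_apply, PowerSeries.coeff_mk, Fin.val_succ,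
      RingHom.mapMatrix_apply, Matrix.map_apply, PowerSeries.coeff_rescale, rhoVar_succ hq₁,
      mul_pow, Fin.val_castSucc]
    ring
  have h3 : (M (n + 2)).submatrix Fin.castSucc Fin.succ =
      (PowerSeries.rescale (q₂ : ℂ)).mapMatrix (M (n + 1)) := by
    ext i j m
    simp only [M, Matrix.submatrix_apply, Matrix.of_apply, PowerSeries.coeff_mk, Fin.val_succ,
      RingHom.mapMatrix_apply, Matrix.map_apply, PowerSeries.coeff_rescale, rhoVar_succ hq₂,
      mul_pow, Fin.val_castSucc]
    ring
  have h4 : (M (n + 2)).submatrix (fun i : Fin n => i.castSucc.succ)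
      (fun i : Fin n => i.castSucc.succ) =
      (PowerSeries.rescale ((q₁ * q₂ : ℝ) : ℂ)).mapMatrix (M n) := by
    ext i j m
    simp only [M, Matrix.submatrix_apply, Matrix.of_apply, PowerSeries.coeff_mk, Fin.val_succ,
      RingHom.mapMatrix_apply, Matrix.map_apply, PowerSeries.coeff_rescale, rhoVar_succ hq₁,
      rhoVar_succ hq₂, mul_pow, Fin.val_castSucc, Complex.ofReal_mul]
    ring
  have h5 : (M (n + 2)).submatrix Fin.castSucc Fin.castSucc = M (n + 1) := rfl
  have hd := desnanot_jacobi (M (n + 2))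
  rw [h1, h2, h3, h4, h5] at hd
  simpa only [momentDet, RingHom.map_det] using hd

/-! ### The bilinear identity for formal power series -/

theorem rescale_C (a c : ℂ) :
    PowerSeries.rescale a (PowerSeries.C c) = PowerSeries.C c := by
  ext d
  rw [PowerSeries.coeff_rescale, PowerSeries.coeff_C]
  split_ifs with h
  · simp [h]
  · simp

/-- The Desnanot–Jacobi identity in terms of the truncated partition functions.  The factors
`1 - q ^ (n + 1)` come from the ratios of the Vandermonde products. -/
theorem truncatedZ_bilinear {q₁ q₂ q : ℝ} (hq₁ : 0 < q₁) (hq₁' : q₁ < 1) (hq₂ : 0 < q₂)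
    (hq₂' : q₂ < 1) (hq : 0 < q) (hq' : q < 1) {t : ℕ+ → ℂ} (ht : Admissible q t) (p : ℤ) (n : ℕ) :
    PowerSeries.rescale ((q₁ * q₂ : ℝ) : ℂ) (truncatedZ q₁ q₂ q t (n + 1) p) *
        truncatedZ q₁ q₂ q t (n + 1) p -
      PowerSeries.rescale (q₁ : ℂ) (truncatedZ q₁ q₂ q t (n + 1) p) *
        PowerSeries.rescale (q₂ : ℂ) (truncatedZ q₁ q₂ q t (n + 1) p) =
    PowerSeries.C (rhoVar q₁ 0 * (1 - (q₁ : ℂ) ^ (n + 1)) *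
        (rhoVar q₂ 0 * (1 - (q₂ : ℂ) ^ (n + 1)))) * PowerSeries.X *
      (truncatedZ q₁ q₂ q t (n + 2) (p + 1) *
        PowerSeries.rescale ((q₁ * q₂ : ℝ) : ℂ) (truncatedZ q₁ q₂ q t n (p - 1))) := by
  set h : ℕ → ℂ := fun m => siteWeight q t (p - (n + 1 : ℕ) + 1 + m) with hh
  set E := Complex.exp (totalPotential q t ⊥ (p - (n + 1 : ℕ)))
  -- the three determinants of sizes `n`, `n + 1`, `n + 2` share the weights `h` and the factor `E`
  have k1 := momentDet_eq_truncatedZ q₁ q₂ hq hq' ht (n + 1) p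
  have k2 := momentDet_eq_truncatedZ q₁ q₂ hq hq' ht (n + 2) (p + 1)
  have k0 := momentDet_eq_truncatedZ q₁ q₂ hq hq' ht n (p - 1)
  rw [show p + 1 - ((n + 2 : ℕ) : ℤ) = p - (n + 1 : ℕ) by push_cast; ring] at k2
  rw [show p - 1 - (n : ℤ) = p - (n + 1 : ℕ) by push_cast; ring] at k0
  rw [← hh] at k0 k1 k2
  have hdj := momentDet_desnanot_jacobi hq₁ hq₂ h n
  have r0 := congrArg (PowerSeries.rescale ((q₁ * q₂ : ℝ) : ℂ)) k0
  have r1 := congrArg (PowerSeries.rescale ((q₁ * q₂ : ℝ) : ℂ)) k1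
  have s1 := congrArg (PowerSeries.rescale (q₁ : ℂ)) k1
  have s2 := congrArg (PowerSeries.rescale (q₂ : ℂ)) k1
  simp only [map_mul, map_pow, rescale_C, PowerSeries.rescale_X] at r0 r1 s1 s2 k1 k2
  have v1 := congrArg (PowerSeries.C (R := ℂ)) (vandermondeProd_rhoVar_mul hq₁ n)
  have v2 := congrArg (PowerSeries.C (R := ℂ)) (vandermondeProd_rhoVar_mul hq₂ n)
  have hc : PowerSeries.C ((q₁ * q₂ : ℝ) : ℂ) =
      PowerSeries.C (q₁ : ℂ) * PowerSeries.C (q₂ : ℂ) := by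
    rw [Complex.ofReal_mul, map_mul]
  have hT1 : ∑ k ∈ range (n + 1), k = ∑ k ∈ range n, k + n := sum_range_succ _ _
  have hT2 : ∑ k ∈ range (n + 2), k = ∑ k ∈ range n, k + n + (n + 1) := by
    rw [sum_range_succ, hT1]
  simp only [map_mul, map_pow, map_neg, hc, hT1, hT2] at r0 r1 s1 s2 k1 k2 v1 v2 ⊢
  have hne : PowerSeries.C (vandermondeProd (rhoVar q₁) (n + 1)) ^ 2 *
      PowerSeries.C (vandermondeProd (rhoVar q₂) (n + 1)) ^ 2 *
      (PowerSeries.C (q₁ : ℂ) * PowerSeries.C (q₂ : ℂ)) ^ (∑ k ∈ range n, k + n) *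
      (PowerSeries.X : PowerSeries ℂ) ^ (2 * (∑ k ∈ range n, k + n)) ≠ 0 := by
    have hC {z : ℂ} (hz : z ≠ 0) : PowerSeries.C z ≠ 0 := by
      rwa [Ne, map_eq_zero_iff _ PowerSeries.C_injective]
    refine mul_ne_zero (mul_ne_zero (mul_ne_zero (pow_ne_zero _ (hC ?_)) (pow_ne_zero _ (hC ?_)))
      (pow_ne_zero _ (mul_ne_zero (hC ?_) (hC ?_)))) (pow_ne_zero _ PowerSeries.X_ne_zero)
    · exact vandermondeProd_rhoVar_ne_zero hq₁ hq₁' _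
    · exact vandermondeProd_rhoVar_ne_zero hq₂ hq₂' _
    · exact_mod_cast hq₁.ne'
    · exact_mod_cast hq₂.ne'
  -- cancel the Vandermonde products and the powers of `q₁ q₂ X`
  refine mul_left_cancel₀ hne ?_
  have e0 := congrArg₂ (· * ·) k2 r0
  have e1 := congrArg₂ (· * ·) r1 k1
  have e2 := congrArg₂ (· * ·) s1 s2
  have v := congrArg₂ (· * ·) v1 v2
  beta_reduce at e0 e1 e2 v
  linear_combination -e1 + e2 + e0 - PowerSeries.C E ^ 2 * hdj +
    (PowerSeries.C (q₁ : ℂ) * PowerSeries.C (q₂ : ℂ)) ^ (∑ k ∈ range n, k) *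
      PowerSeries.X ^ (2 * (∑ k ∈ range n, k) + 2 * n + 1) *
      (truncatedZ q₁ q₂ q t (n + 2) (p + 1) *
        PowerSeries.rescale ((q₁ * q₂ : ℝ) : ℂ) (truncatedZ q₁ q₂ q t n (p - 1))) * v

/-- The partition function without the vacuum energy `p(p+1)/2`. -/
noncomputable def reducedZ (q₁ q₂ q : ℝ) (t : ℕ+ → ℂ) (p : ℤ) : PowerSeries ℂ :=
  PowerSeries.mk fun e => ∑ μ ∈ (finite_energy_eq 0 e).toFinset, weight q₁ q₂ q t p μ

open scoped PowerSeries.WithPiTopology in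
theorem tendsto_truncatedZ {q₁ q₂ : ℝ} (hq₁ : 0 < q₁) (hq₁' : q₁ < 1) (hq₂ : 0 < q₂)
    (hq₂' : q₂ < 1) (q : ℝ) (t : ℕ+ → ℂ) (p : ℤ) :
    Tendsto (fun n => truncatedZ q₁ q₂ q t n p) atTop (𝓝 (reducedZ q₁ q₂ q t p)) := by
  rw [PowerSeries.WithPiTopology.tendsto_iff_coeff_tendsto]
  intro e
  simp only [truncatedZ, reducedZ, PowerSeries.coeff_mk]
  exact tendsto_finsetSum _ fun μ _ =>
    ((tendsto_schurPoly hq₁ hq₁' μ).mul (tendsto_schurPoly hq₂ hq₂' μ)).mul_const _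

open scoped PowerSeries.WithPiTopology in
theorem continuous_rescale (c : ℂ) : Continuous (PowerSeries.rescale c) := by
  rw [continuous_iff_continuousAt]
  intro F
  rw [ContinuousAt, PowerSeries.WithPiTopology.tendsto_iff_coeff_tendsto]
  intro d
  simp only [PowerSeries.coeff_rescale]
  exact ((PowerSeries.WithPiTopology.continuous_coeff ℂ d).tendsto F).const_mul _

open scoped PowerSeries.WithPiTopology in
theorem reducedZ_bilinear {q₁ q₂ q : ℝ} (hq₁ : 0 < q₁) (hq₁' : q₁ < 1) (hq₂ : 0 < q₂)
    (hq₂' : q₂ < 1) (hq : 0 < q) (hq' : q < 1) {t : ℕ+ → ℂ} (ht : Admissible q t) (p : ℤ) :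
    PowerSeries.rescale ((q₁ * q₂ : ℝ) : ℂ) (reducedZ q₁ q₂ q t p) * reducedZ q₁ q₂ q t p -
      PowerSeries.rescale (q₁ : ℂ) (reducedZ q₁ q₂ q t p) *
        PowerSeries.rescale (q₂ : ℂ) (reducedZ q₁ q₂ q t p) =
    PowerSeries.C (rhoVar q₁ 0 * rhoVar q₂ 0) * PowerSeries.X *
      (reducedZ q₁ q₂ q t (p + 1) *
        PowerSeries.rescale ((q₁ * q₂ : ℝ) : ℂ) (reducedZ q₁ q₂ q t (p - 1))) := by
  have hZ (p : ℤ) := tendsto_truncatedZ hq₁ hq₁' hq₂ hq₂' q t p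
  have h1 := (hZ p).comp (tendsto_add_atTop_nat 1)
  have h2 := (hZ (p + 1)).comp (tendsto_add_atTop_nat 2)
  have hr (c : ℂ) {F : ℕ → PowerSeries ℂ} {G : PowerSeries ℂ} (h : Tendsto F atTop (𝓝 G)) :
      Tendsto (fun n => PowerSeries.rescale c (F n)) atTop (𝓝 (PowerSeries.rescale c G)) :=
    ((continuous_rescale c).tendsto G).comp h
  have hpow {a : ℝ} (ha : 0 < a) (ha' : a < 1) :
      Tendsto (fun n : ℕ => rhoVar a 0 * (1 - (a : ℂ) ^ (n + 1))) atTop (𝓝 (rhoVar a 0)) := by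
    have h := (tendsto_pow_atTop_nhds_zero_of_norm_lt_one (x := (a : ℂ))
      (by rwa [Complex.norm_real, Real.norm_of_nonneg ha.le])).comp (tendsto_add_atTop_nat 1)
    simpa using (h.const_sub 1).const_mul (rhoVar a 0)
  have hc := (PowerSeries.WithPiTopology.continuous_C (R := ℂ)).tendsto _ |>.comp
    ((hpow hq₁ hq₁').mul (hpow hq₂ hq₂'))
  have hL := ((hr ((q₁ * q₂ : ℝ) : ℂ) h1).mul h1).sub ((hr (q₁ : ℂ) h1).mul (hr (q₂ : ℂ) h1))
  have hR := (hc.mul_const PowerSeries.X).mul (h2.mul (hr ((q₁ * q₂ : ℝ) : ℂ) (hZ (p - 1))))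
  refine tendsto_nhds_unique hL (hR.congr fun n => ?_)
  exact (truncatedZ_bilinear hq₁ hq₁' hq₂ hq₂' hq hq' ht p n).symm

theorem two_mul_toNat_energy (p : ℤ) : 2 * ((p * (p + 1) / 2).toNat : ℤ) = p * (p + 1) := by
  have h1 : 2 ∣ p * (p + 1) := (Int.even_mul_succ_self p).two_dvd
  have h2 : 0 ≤ p * (p + 1) := by
    rcases le_or_gt 0 p with h | h
    · positivity
    · exact mul_nonneg_of_nonpos_of_nonpos h.le (by omega)
  omega

theorem formalZ_eq_X_pow_mul (q₁ q₂ q : ℝ) (t : ℕ+ → ℂ) (p : ℤ) :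
    formalZ q₁ q₂ q t p =
      PowerSeries.X ^ (p * (p + 1) / 2).toNat * reducedZ q₁ q₂ q t p := by
  ext d
  rw [formalZ, reducedZ, PowerSeries.coeff_mk, PowerSeries.coeff_X_pow_mul']
  split_ifs with hd
  · rw [PowerSeries.coeff_mk]
    refine sum_congr ?_ fun _ _ => rfl
    ext μ
    rw [mem_finite_energy_zero, Set.Finite.mem_toFinset, Set.mem_ofPred_eq, energy]
    omega
  · refine sum_eq_zero fun μ hμ => absurd ?_ hd
    rw [Set.Finite.mem_toFinset, Set.mem_ofPred_eq, energy] at hμ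
    omega

theorem formalZ_bilinear {q₁ q₂ q : ℝ} (hq₁ : 0 < q₁) (hq₁' : q₁ < 1) (hq₂ : 0 < q₂)
    (hq₂' : q₂ < 1) (hq : 0 < q) (hq' : q < 1) {t : ℕ+ → ℂ} (ht : Admissible q t) (p : ℤ) :
    PowerSeries.rescale ((q₁ * q₂ : ℝ) : ℂ) (formalZ q₁ q₂ q t p) * formalZ q₁ q₂ q t p -
      PowerSeries.rescale (q₁ : ℂ) (formalZ q₁ q₂ q t p) *
        PowerSeries.rescale (q₂ : ℂ) (formalZ q₁ q₂ q t p) =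
    PowerSeries.C (((q₁ * q₂) ^ ((p : ℝ) + 1 / 2) : ℝ) : ℂ) * formalZ q₁ q₂ q t (p + 1) *
      PowerSeries.rescale ((q₁ * q₂ : ℝ) : ℂ) (formalZ q₁ q₂ q t (p - 1)) := by
  have hb := reducedZ_bilinear hq₁ hq₁' hq₂ hq₂' hq hq' ht p
  have t0 := two_mul_toNat_energy p
  have t1 := two_mul_toNat_energy (p + 1)
  have t2 := two_mul_toNat_energy (p - 1)
  simp only [formalZ_eq_X_pow_mul]
  set a := (p * (p + 1) / 2).toNat
  set b := ((p + 1) * (p + 1 + 1) / 2).toNat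
  set c := ((p - 1) * (p - 1 + 1) / 2).toNat
  have hbc : b + c = 2 * a + 1 := by
    zify
    linarith
  have hac : (a : ℤ) = c + p := by linarith
  -- the vacuum energies turn the constant `(q₁ q₂)^{1/2}` into `(q₁ q₂)^{p + 1/2}`
  have hconst : ((q₁ * q₂ : ℝ) : ℂ) ^ a * (rhoVar q₁ 0 * rhoVar q₂ 0) =
      (((q₁ * q₂) ^ ((p : ℝ) + 1 / 2) : ℝ) : ℂ) * ((q₁ * q₂ : ℝ) : ℂ) ^ c := by
    have hpos : 0 < q₁ * q₂ := mul_pos hq₁ hq₂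
    have hac' : (a : ℝ) = c + p := by exact_mod_cast hac
    rw [rhoVar, rhoVar, ← Complex.ofReal_mul, ← Complex.ofReal_pow, ← Complex.ofReal_mul,
      ← Complex.ofReal_pow, ← Complex.ofReal_mul, ← Real.mul_rpow hq₁.le hq₂.le,
      ← Real.rpow_natCast, ← Real.rpow_natCast, ← Real.rpow_add hpos, ← Real.rpow_add hpos, hac']
    congr 2
    push_cast
    ring
  have hconst' := congrArg (PowerSeries.C (R := ℂ)) hconst
  have hc : PowerSeries.C ((q₁ * q₂ : ℝ) : ℂ) =
      PowerSeries.C (q₁ : ℂ) * PowerSeries.C (q₂ : ℂ) := by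
    rw [Complex.ofReal_mul, map_mul]
  have hX : (PowerSeries.X : PowerSeries ℂ) ^ b * PowerSeries.X ^ c =
      PowerSeries.X ^ (2 * a + 1) := by
    rw [← pow_add, hbc]
  simp only [map_mul, map_pow, PowerSeries.rescale_X, hc] at hb hconst' ⊢
  linear_combination (PowerSeries.C (q₁ : ℂ) * PowerSeries.C (q₂ : ℂ)) ^ a *
      PowerSeries.X ^ (2 * a) * hb +
    PowerSeries.X ^ (2 * a + 1) * (reducedZ q₁ q₂ q t (p + 1) *
      PowerSeries.rescale ((q₁ * q₂ : ℝ) : ℂ) (reducedZ q₁ q₂ q t (p - 1))) * hconst' -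
    PowerSeries.C (((q₁ * q₂) ^ ((p : ℝ) + 1 / 2) : ℝ) : ℂ) *
      (PowerSeries.C (q₁ : ℂ) * PowerSeries.C (q₂ : ℂ)) ^ c * (reducedZ q₁ q₂ q t (p + 1) *
      PowerSeries.rescale ((q₁ * q₂ : ℝ) : ℂ) (reducedZ q₁ q₂ q t (p - 1))) * hX

/-! ### Evaluation at a complex number -/

theorem hasSum_coeff_mul {F G : PowerSeries ℂ} {Q z w : ℂ}
    (hF : HasSum (fun d => PowerSeries.coeff d F * Q ^ d) z)
    (hG : HasSum (fun d => PowerSeries.coeff d G * Q ^ d) w) :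
    HasSum (fun d => PowerSeries.coeff d (F * G) * Q ^ d) (z * w) := by
  have h1 := hF.summable.norm
  have h2 := hG.summable.norm
  have h : (fun d => PowerSeries.coeff d (F * G) * Q ^ d) = fun d => ∑ kl ∈ antidiagonal d,
      PowerSeries.coeff kl.1 F * Q ^ kl.1 * (PowerSeries.coeff kl.2 G * Q ^ kl.2) := by
    ext d
    rw [PowerSeries.coeff_mul, sum_mul]
    refine sum_congr rfl fun kl hkl => ?_
    rw [← mem_antidiagonal.1 hkl, pow_add]
    ring
  rw [h, ← hF.tsum_eq, ← hG.tsum_eq, tsum_mul_tsum_eq_tsum_sum_antidiagonal_of_summable_norm h1 h2]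
  exact (summable_norm_sum_mul_antidiagonal_of_summable_norm h1 h2).of_norm.hasSum

theorem hasSum_coeff_rescale {F : PowerSeries ℂ} {c Q z : ℂ}
    (hF : HasSum (fun d => PowerSeries.coeff d F * (c * Q) ^ d) z) :
    HasSum (fun d => PowerSeries.coeff d (PowerSeries.rescale c F) * Q ^ d) z := by
  refine hF.congr_fun ?_
  intro d
  rw [PowerSeries.coeff_rescale, mul_pow]
  ring

/-- If the sum over all partitions converges absolutely, then so does the power series obtained by
collecting the partitions of equal energy. -/
theorem hasSum_coeff_formalZ {q₁ q₂ q : ℝ} {t : ℕ+ → ℂ} {Q : ℂ} {p : ℤ}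
    (h : Summable (term q₁ q₂ q t Q p)) :
    HasSum (fun d => PowerSeries.coeff d (formalZ q₁ q₂ q t p) * Q ^ d) (numZ q₁ q₂ q t Q p) := by
  have h1 := h.hasSum.tsum_fiberwise fun μ => energy μ p
  refine h1.congr_fun ?_
  intro d
  rw [formalZ, PowerSeries.coeff_mk, sum_mul]
  have hset : (fun μ => energy μ p) ⁻¹' {d} = ((finite_energy_eq p d).toFinset : Set _) := by
    ext μ
    simp
  rw [hset, Finset.tsum_subtype' (finite_energy_eq p d).toFinset (term q₁ q₂ q t Q p)]
  refine sum_congr rfl fun μ hμ => ?_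
  rw [Set.Finite.mem_toFinset, Set.mem_ofPred_eq] at hμ
  rw [term, hμ]

theorem summable_term_mul {q₁ q₂ q : ℝ} {t : ℕ+ → ℂ} {Q : ℂ} {p : ℤ}
    (h : Summable (term q₁ q₂ q t Q p)) {c : ℂ} (hc : ‖c‖ ≤ 1) :
    Summable (term q₁ q₂ q t (c * Q) p) := by
  refine Summable.of_norm_bounded h.norm fun μ => ?_
  rw [term, term, mul_pow, mul_left_comm, norm_mul, norm_pow]
  exact mul_le_of_le_one_left (norm_nonneg _) (pow_le_one₀ (norm_nonneg _) hc)

end MeltingCrystal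

theorem theorem3 (q₁ q₂ q : ℝ) (hq₁ : 0 < q₁) (hq₁' : q₁ < 1) (hq₂ : 0 < q₂) (hq₂' : q₂ < 1)
    (hq : 0 < q) (hq' : q < 1) (t : ℕ+ → ℂ) (ht : MeltingCrystal.Admissible q t) (p : ℤ) :
    -- the equation between formal power series in `Q`
    (PowerSeries.rescale ((q₁ * q₂ : ℝ) : ℂ) (MeltingCrystal.formalZ q₁ q₂ q t p)
          * MeltingCrystal.formalZ q₁ q₂ q t p
        - PowerSeries.rescale (q₁ : ℂ) (MeltingCrystal.formalZ q₁ q₂ q t p)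
          * PowerSeries.rescale (q₂ : ℂ) (MeltingCrystal.formalZ q₁ q₂ q t p)
      = PowerSeries.C (((q₁ * q₂) ^ ((p : ℝ) + 1 / 2) : ℝ) : ℂ)
          * MeltingCrystal.formalZ q₁ q₂ q t (p + 1)
          * PowerSeries.rescale ((q₁ * q₂ : ℝ) : ℂ) (MeltingCrystal.formalZ q₁ q₂ q t (p - 1))) ∧
    -- the equation at every numerical value of `Q` at which the partition functions converge
    (∀ Q : ℂ,
      Summable (MeltingCrystal.term q₁ q₂ q t Q p) →
      Summable (MeltingCrystal.term q₁ q₂ q t Q (p + 1)) →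
      Summable (MeltingCrystal.term q₁ q₂ q t ((q₁ * q₂ : ℝ) * Q) (p - 1)) →
      MeltingCrystal.numZ q₁ q₂ q t ((q₁ * q₂ : ℝ) * Q) p * MeltingCrystal.numZ q₁ q₂ q t Q p
        - MeltingCrystal.numZ q₁ q₂ q t (q₁ * Q) p * MeltingCrystal.numZ q₁ q₂ q t (q₂ * Q) p
      = (((q₁ * q₂) ^ ((p : ℝ) + 1 / 2) : ℝ) : ℂ)
          * MeltingCrystal.numZ q₁ q₂ q t Q (p + 1)
          * MeltingCrystal.numZ q₁ q₂ q t ((q₁ * q₂ : ℝ) * Q) (p - 1)) := by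
  have hformal := MeltingCrystal.formalZ_bilinear hq₁ hq₁' hq₂ hq₂' hq hq' ht p
  refine ⟨hformal, fun Q h0 h1 h2 => ?_⟩
  have hn {a : ℝ} (ha : 0 < a) (ha' : a < 1) : ‖(a : ℂ)‖ ≤ 1 := by
    rw [Complex.norm_real, Real.norm_of_nonneg ha.le]
    exact ha'.le
  have h12 : ‖((q₁ * q₂ : ℝ) : ℂ)‖ ≤ 1 :=
    hn (mul_pos hq₁ hq₂) (mul_lt_one_of_nonneg_of_lt_one_left hq₁.le hq₁' hq₂'.le)
  have hz := MeltingCrystal.hasSum_coeff_formalZ h0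
  have hr {c : ℂ} (hc : ‖c‖ ≤ 1) := MeltingCrystal.hasSum_coeff_rescale
    (MeltingCrystal.hasSum_coeff_formalZ (MeltingCrystal.summable_term_mul h0 hc))
  have hL := (MeltingCrystal.hasSum_coeff_mul (hr h12) hz).sub
    (MeltingCrystal.hasSum_coeff_mul (hr (hn hq₁ hq₁')) (hr (hn hq₂ hq₂')))
  have hR := (MeltingCrystal.hasSum_coeff_mul (MeltingCrystal.hasSum_coeff_formalZ h1)
    (MeltingCrystal.hasSum_coeff_rescale (MeltingCrystal.hasSum_coeff_formalZ h2))).mul_left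
      (((q₁ * q₂) ^ ((p : ℝ) + 1 / 2) : ℝ) : ℂ)
  rw [mul_assoc]
  refine hL.unique (hR.congr_fun fun d => ?_)
  rw [← sub_mul, ← map_sub, hformal, mul_assoc (PowerSeries.C _), PowerSeries.coeff_C_mul]
  ring
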